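/- Let $k$ be an algebraically closed field of characteristic $p\ge 3$, let $r\ge 1$, let $\rho_1,\dots,\rho_r\in k$ be distinct, let $l_1,\dots,l_r\ge 1$ be integers prime to $p$, and let $f\in k[x]$ be a polynomial of degree $\sum_i l_i$ that is prime to $\prod_i(x-\rho_i)^{l_i}$ and satisfies $f(0)\neq 0$. Let $X$ be the smooth projective curve over $k$ whose function field is $k(x,y)$, where $x$ is transcendental over $k$ and $$y^p-y=\frac{f(x)}{\prod_{i=1}^r(x-\rho_i)^{l_i}} .$$ Let $U_0$ and $U_\infty$ be the complements in $X$ of the fibres of $x:X\to\mathbb{P}^1$ above $0$ and $\infty$, and describe $H^1_{dR}(X/k)$ by Čech cocycles for this covering: $$H^1_{dR}(X/k)=\frac{\{(\omega_0,\omega_\infty,h)\in\Omega_X(U_0)\times\Omega_X(U_\infty)\times\mathcal{O}_X(U_0\cap U_\infty)\ :\ dh=\omega_0-\omega_\infty\}}{\{(dh_0,dh_\infty,h_0-h_\infty)\ :\ h_0\in\mathcal{O}_X(U_0),\ h_\infty\in\mathcal{O}_X(U_\infty)\}} .$$ For $0\le\mu\le p-1$ put $$m_i^{(\mu)}=\Big\lfloor\frac{(p-1-\mu)l_i+(p-1)}{p}\Big\rfloor,\qquad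 t^{(\mu)}=\sum_{i=1}^r m_i^{(\mu)},\qquad g_\mu(x)=\prod_{i=1}^r(x-\rho_i)^{m_i^{(\mu)}},$$ and $\omega_{\mu,\nu}=x^{\nu-1}\frac{y^\mu}{g_\mu(x)}\,dx$ for $\nu\ge1$. Put $$\psi(x)=f(x)\sum_{i=1}^r l_i\prod_{j\ne i}(x-\rho_j)-f'(x)\prod_{i=1}^r(x-\rho_i).$$ For $1\le\mu\le p$ with $t^{(p-\mu)}\ge2$ (so that $\mu\ge2$, since $t^{(p-1)}=0$) and $1\le\nu\le t^{(p-\mu)}-1$ put $$\varphi_{\mu,\nu}(x)=x\,g_{p-\mu}'(x)g_{\mu-1}(x)-\nu\,g_{p-\mu}(x)g_{\mu-1}(x),$$ $$\omega_\mu=\frac{(\mu-1)\,g_{p-\mu}(x)\,y^{\mu-2}}{\prod_{i=1}^r(x-\rho_i)^{l_i+1}}\,dx,\qquad \tilde h_{\mu,\nu}=\frac{g_{p-\mu}(x)\,y^{\mu-1}}{x^\nu}.$$ For a polynomial $h$ let $h^{<n}$ and $h^{\ge n}$ denote the sums of its monomials of degree $<n$ and $\ge n$, respectively. Then the triples below are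 cocycles, and the classes $$a_{\mu,\nu}=\Big[\Big(\tfrac{\varphi_{\mu,\nu}^{<\nu+1}(x)}{x^{\nu+1}}\omega_{\mu-1,1}+\tfrac{\psi^{<\nu}(x)}{x^\nu}\omega_\mu,\ -\tfrac{\varphi_{\mu,\nu}^{\ge\nu+1}(x)}{x^{\nu+1}}\omega_{\mu-1,1}-\tfrac{\psi^{\ge\nu}(x)}{x^\nu}\omega_\mu,\ \tilde h_{\mu,\nu}\Big)\Big]$$ for $1\le\mu\le p$ with $t^{(p-\mu)}\ge2$ and $1\le\nu\le t^{(p-\mu)}-1$, together with the classes $$\delta_{\mu,\nu}=[(\omega_{\mu,\nu},\,\omega_{\mu,\nu},\,0)]$$ for $0\le\mu\le p-1$ with $t^{(\mu)}\ge2$ and $1\le\nu\le t^{(\mu)}-1$, form a basis of $H^1_{dR}(X/k)$ as a $k$-vector space. -/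

import Mathlib

open Polynomial
open scoped KaehlerDifferential

/-! ### The smooth projective curve of a function field, through its places

The closed points of the smooth projective curve `X` over the algebraically closed field `k` with
function field `F` are the valuation rings of `F` that contain `k` and are different from `F`. -/

/-- A closed point of `X`: a valuation ring of `F`, containing `k` and different from `F`;
the valuation ring is the local ring of `X` at the point. -/
structure CurvePoint (k F : Type*) [Field k] [Field F] [Algebra k F] where
  localRing : ValuationSubring F
  algebraMap_mem : ∀ c : k, algebraMap k F c ∈ localRing
  ne_top : localRing ≠ ⊤

namespace CurvePoint

variable {k F : Type*} [Field k] [Field F] [Algebra k F]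

/-- The stalk of `Ω_X` at the point `P`, inside the differentials `Ω[F⁄k]` of the function field:
the `𝒪_{X,P}`-submodule generated by the differentials of the elements of `𝒪_{X,P}`. -/
noncomputable def differentials (P : CurvePoint k F) : Submodule P.localRing.toSubring (Ω[F⁄k]) :=
  Submodule.span P.localRing.toSubring
    {ω | ∃ f : F, f ∈ P.localRing ∧ ω = KaehlerDifferential.D k F f}

end CurvePoint

section Curve

variable {k F : Type*} [Field k] [Field F] [Algebra k F]

/-- `𝒪_X(U)`: the rational functions that are regular at every point of `U`. -/
def regularFunctions (U : Set (CurvePoint k F)) : Submodule k F where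
  carrier := {f | ∀ P ∈ U, f ∈ P.localRing}
  add_mem' hf hg P hP := add_mem (hf P hP) (hg P hP)
  zero_mem' P _ := zero_mem P.localRing
  smul_mem' c f hf P hP := by
    rw [Algebra.smul_def]
    exact mul_mem (P.algebraMap_mem c) (hf P hP)

/-- `Ω_X(U)`: the rational differentials that are regular at every point of `U`. -/
def regularDifferentials (U : Set (CurvePoint k F)) : Submodule k (Ω[F⁄k]) where
  carrier := {ω | ∀ P ∈ U, ω ∈ P.differentials}
  add_mem' hf hg P hP := add_mem (hf P hP) (hg P hP)
  zero_mem' P _ := zero_mem P.differentials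
  smul_mem' c ω hω P hP := by
    have h := P.differentials.smul_mem (⟨algebraMap k F c, P.algebraMap_mem c⟩ :
      P.localRing.toSubring) (hω P hP)
    rw [← algebraMap_smul F c ω]
    exact h

/-- The points of `X` above `a ∈ k ⊆ ℙ¹`, for the map `X → ℙ¹` given by the rational function `x`:
the points at which `x - a` lies in the maximal ideal of the local ring. -/
def fibre (x : F) (a : k) : Set (CurvePoint k F) :=
  {P | x - algebraMap k F a ∈ P.localRing.nonunits}

/-- The points of `X` above `∞ ∈ ℙ¹`: the poles of `x`. -/
def fibreInfty (k : Type*) {F : Type*} [Field k] [Field F] [Algebra k F] (x : F) :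
    Set (CurvePoint k F) :=
  {P | x ∉ P.localRing}

/-- `U_0`, the complement in `X` of the fibre above `0`. -/
def openZero (k : Type*) {F : Type*} [Field k] [Field F] [Algebra k F] (x : F) :
    Set (CurvePoint k F) :=
  (fibre x (0 : k))ᶜ

/-- `U_∞`, the complement in `X` of the fibre above `∞`. -/
def openInfty (k : Type*) {F : Type*} [Field k] [Field F] [Algebra k F] (x : F) :
    Set (CurvePoint k F) :=
  (fibreInfty k x)ᶜ

/-- The Čech–de Rham 1-cocycles for the covering `X = U_0 ∪ U_∞`: triples `(ω_0, ω_∞, f)` in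
`Ω_X(U_0) × Ω_X(U_∞) × 𝒪_X(U_0 ∩ U_∞)` with `df = ω_0 - ω_∞`. -/
def deRhamCocycles (k : Type*) {F : Type*} [Field k] [Field F] [Algebra k F] (x : F) :
    Submodule k (Ω[F⁄k] × Ω[F⁄k] × F) where
  carrier := {c | c.1 ∈ regularDifferentials (openZero k x) ∧
    c.2.1 ∈ regularDifferentials (openInfty k x) ∧
    c.2.2 ∈ regularFunctions (openZero k x ∩ openInfty k x) ∧
    KaehlerDifferential.D k F c.2.2 = c.1 - c.2.1}
  add_mem' := by
    rintro a b ⟨h1, h2, h3, h4⟩ ⟨h1', h2', h3', h4'⟩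
    refine ⟨add_mem h1 h1', add_mem h2 h2', add_mem h3 h3', ?_⟩
    simp only [Prod.snd_add, Prod.fst_add, map_add, h4, h4']
    abel
  zero_mem' := ⟨zero_mem _, zero_mem _, zero_mem _, by simp⟩
  smul_mem' := by
    rintro c a ⟨h1, h2, h3, h4⟩
    refine ⟨Submodule.smul_mem _ c h1, Submodule.smul_mem _ c h2, Submodule.smul_mem _ c h3, ?_⟩
    simp only [Prod.smul_snd, Prod.smul_fst, Derivation.map_smul, h4, smul_sub]

/-- The Čech–de Rham 1-coboundaries: the triples `(df_0, df_∞, f_0 - f_∞)` with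
`f_0 ∈ 𝒪_X(U_0)` and `f_∞ ∈ 𝒪_X(U_∞)`. -/
def deRhamCoboundaries (k : Type*) {F : Type*} [Field k] [Field F] [Algebra k F] (x : F) :
    Submodule k (Ω[F⁄k] × Ω[F⁄k] × F) where
  carrier := {c | ∃ f₀ ∈ regularFunctions (openZero k x),
    ∃ f₁ ∈ regularFunctions (openInfty k x),
      c = (KaehlerDifferential.D k F f₀, KaehlerDifferential.D k F f₁, f₀ - f₁)}
  add_mem' := by
    rintro _ _ ⟨f, hf, g, hg, rfl⟩ ⟨f', hf', g', hg', rfl⟩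
    refine ⟨f + f', add_mem hf hf', g + g', add_mem hg hg', ?_⟩
    simp only [map_add, Prod.mk_add_mk]
    congr 2
    ring
  zero_mem' := ⟨0, zero_mem _, 0, zero_mem _, by simp only [map_zero, sub_zero]; rfl⟩
  smul_mem' := by
    rintro c _ ⟨f, hf, g, hg, rfl⟩
    refine ⟨c • f, Submodule.smul_mem _ c hf, c • g, Submodule.smul_mem _ c hg, ?_⟩
    simp only [Derivation.map_smul, Prod.smul_mk, smul_sub]

theorem deRhamCoboundaries_le (x : F) : deRhamCoboundaries k x ≤ deRhamCocycles k x := by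
  have key : ∀ (P : CurvePoint k F) (f : F), f ∈ P.localRing →
      KaehlerDifferential.D k F f ∈ P.differentials :=
    fun P f hf => Submodule.subset_span ⟨f, hf, rfl⟩
  rintro _ ⟨f, hf, g, hg, rfl⟩
  exact ⟨fun P hP => key P f (hf P hP), fun P hP => key P g (hg P hP),
    fun P hP => sub_mem (hf P hP.1) (hg P hP.2), by simp⟩

/-- `H¹_dR(X/k)`: Čech–de Rham cocycles modulo coboundaries. -/
abbrev DeRhamH1 (k : Type*) {F : Type*} [Field k] [Field F] [Algebra k F] (x : F) : Type _ :=
  deRhamCocycles k x ⧸ (deRhamCoboundaries k x).submoduleOf (deRhamCocycles k x)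

/-- The class of a cocycle in `H¹_dR(X/k)`. -/
noncomputable def deRhamClass (x : F) (c : Ω[F⁄k] × Ω[F⁄k] × F) (hc : c ∈ deRhamCocycles k x) :
    DeRhamH1 k x :=
  Submodule.Quotient.mk ⟨c, hc⟩

end Curve

/-! ### The explicit functions and differentials of an Artin–Schreier cover -/

namespace ArtinSchreier

noncomputable section

/-- `h^{< n}`: the sum of the monomials of `h` of degree `< n`. -/
def lowPart {k : Type*} [Field k] (n : ℕ) (h : k[X]) : k[X] :=
  ∑ i ∈ h.support with i < n, monomial i (h.coeff i)

/-- `h^{≥ n}`: the sum of the monomials of `h` of degree `≥ n`. -/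
def highPart {k : Type*} [Field k] (n : ℕ) (h : k[X]) : k[X] :=
  ∑ i ∈ h.support with n ≤ i, monomial i (h.coeff i)

/-- `m_i^{(μ)}` for `l_i = l`: the quotient of `(p - 1 - μ) l + (p - 1)` by `p`
(used for `0 ≤ μ ≤ p - 1` only). -/
def m (p μ l : ℕ) : ℕ := ((p - 1 - μ) * l + (p - 1)) / p

/-- `t^{(μ)} = ∑ i, m_i^{(μ)}`. -/
def t {r : ℕ} (p : ℕ) (l : Fin r → ℕ) (μ : ℕ) : ℕ := ∑ i, m p μ (l i)

variable {k F : Type*} [Field k] [Field F] [Algebra k F] {r : ℕ}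

/-- `g_μ(x) = ∏ i, (x - ρ_i) ^ m_i^{(μ)}`. -/
def g (p : ℕ) (ρ : Fin r → k) (l : Fin r → ℕ) (μ : ℕ) : k[X] :=
  ∏ i, (X - C (ρ i)) ^ m p μ (l i)

/-- `φ_{μ,ν} = x g_{p-μ}' g_{μ-1} - ν g_{p-μ} g_{μ-1}`. -/
def phi (p : ℕ) (ρ : Fin r → k) (l : Fin r → ℕ) (μ ν : ℕ) : k[X] :=
  X * derivative (g p ρ l (p - μ)) * g p ρ l (μ - 1)
    - C (ν : k) * g p ρ l (p - μ) * g p ρ l (μ - 1)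

/-- `ψ = f ∑ i, l_i ∏ j ≠ i, (x - ρ_j) - f' ∏ i, (x - ρ_i)`. -/
def psi (ρ : Fin r → k) (l : Fin r → ℕ) (f : k[X]) : k[X] :=
  f * ∑ i, C (l i : k) * ∏ j ∈ Finset.univ.erase i, (X - C (ρ j))
    - derivative f * ∏ i, (X - C (ρ i))

/-- `ω_{μ,ν} = x^{ν-1} (y^μ / g_μ(x)) dx`, for `ν ≥ 1`. -/
def omegaHol (p : ℕ) (ρ : Fin r → k) (l : Fin r → ℕ) (x y : F) (μ ν : ℕ) : Ω[F⁄k] :=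
  (x ^ (ν - 1) * (y ^ μ / aeval x (g p ρ l μ))) • KaehlerDifferential.D k F x

/-- `ω_μ = ((μ - 1) g_{p-μ}(x) y^{μ-2} / ∏ i, (x - ρ_i)^{l_i + 1}) dx`, for `μ ≥ 2`. -/
def omega (p : ℕ) (ρ : Fin r → k) (l : Fin r → ℕ) (x y : F) (μ : ℕ) : Ω[F⁄k] :=
  (((μ : F) - 1) * aeval x (g p ρ l (p - μ)) * y ^ (μ - 2)
    / ∏ i, (x - algebraMap k F (ρ i)) ^ (l i + 1)) • KaehlerDifferential.D k F x

/-- `h̃_{μ,ν} = g_{p-μ}(x) y^{μ-1} / x^ν`, for `μ ≥ 1`. -/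
def hTilde (p : ℕ) (ρ : Fin r → k) (l : Fin r → ℕ) (x y : F) (μ ν : ℕ) : F :=
  aeval x (g p ρ l (p - μ)) * y ^ (μ - 1) / x ^ ν

/-- The triple `(ω_{μ,ν}, ω_{μ,ν}, 0)` whose class is `δ_{μ,ν}`. -/
def deltaTriple (p : ℕ) (ρ : Fin r → k) (l : Fin r → ℕ) (x y : F) (μ ν : ℕ) :
    Ω[F⁄k] × Ω[F⁄k] × F :=
  (omegaHol p ρ l x y μ ν, omegaHol p ρ l x y μ ν, 0)

/-- The triple whose class is `a_{μ,ν}`: its components are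
`(φ_{μ,ν}^{<ν+1} / x^{ν+1}) ω_{μ-1,1} + (ψ^{<ν} / x^ν) ω_μ`,
`-((φ_{μ,ν}^{≥ν+1} / x^{ν+1}) ω_{μ-1,1} + (ψ^{≥ν} / x^ν) ω_μ)` and `h̃_{μ,ν}`.
The sign of the second one is the one for which `dh̃_{μ,ν} = ω_0 - ω_∞`. -/
def aTriple (p : ℕ) (ρ : Fin r → k) (l : Fin r → ℕ) (f : k[X]) (x y : F) (μ ν : ℕ) :
    Ω[F⁄k] × Ω[F⁄k] × F :=
  ((aeval x (lowPart (ν + 1) (phi p ρ l μ ν)) / x ^ (ν + 1)) • omegaHol p ρ l x y (μ - 1) 1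
      + (aeval x (lowPart ν (psi ρ l f)) / x ^ ν) • omega p ρ l x y μ,
    -((aeval x (highPart (ν + 1) (phi p ρ l μ ν)) / x ^ (ν + 1)) • omegaHol p ρ l x y (μ - 1) 1
      + (aeval x (highPart ν (psi ρ l f)) / x ^ ν) • omega p ρ l x y μ),
    hTilde p ρ l x y μ ν)

/-- The pairs `(μ, ν)` that index the classes `δ_{μ,ν}`:
`0 ≤ μ ≤ p - 1`, `t^{(μ)} ≥ 2` and `1 ≤ ν ≤ t^{(μ)} - 1`. -/
def DeltaIndex (p : ℕ) {r : ℕ} (l : Fin r → ℕ) : Type :=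
  {q : ℕ × ℕ // q.1 ≤ p - 1 ∧ 2 ≤ t p l q.1 ∧ 1 ≤ q.2 ∧ q.2 ≤ t p l q.1 - 1}

/-- The pairs `(μ, ν)` that index the classes `a_{μ,ν}`:
`1 ≤ μ ≤ p`, `t^{(p-μ)} ≥ 2` and `1 ≤ ν ≤ t^{(p-μ)} - 1`. As `t^{(p-1)} = 0`, they have `μ ≥ 2`. -/
def AIndex (p : ℕ) {r : ℕ} (l : Fin r → ℕ) : Type :=
  {q : ℕ × ℕ // 1 ≤ q.1 ∧ q.1 ≤ p ∧ 2 ≤ t p l (p - q.1) ∧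
    1 ≤ q.2 ∧ q.2 ≤ t p l (p - q.1) - 1}

end

end ArtinSchreier

/-! ### Valuations at the points of the curve -/

/-! The classes fit into the sequence 0 → H⁰(X, Ω) → H¹_dR → H¹(X, 𝒪), in which the first map sends
ω to (ω, ω, 0) and the second keeps the function of a cocycle. The `δ` are the images of a basis of
H⁰(X, Ω), and the `a` are cocycles whose functions `h̃` form a basis of H¹(X, 𝒪). So the last map is
onto, and the two families together form a basis. Dimensions are never counted: both outer bases are
computed by hand.

Every function is a unique sum ∑ a_μ y^μ with μ < p and a_μ in k(x), and regularity over a point of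
the x-line is a condition on each coefficient separately. Over ρ_i one has v(y)^p = v(x -
ρ_i)^(-l_i). As l_i is prime to p, nonzero terms have distinct values, so nothing cancels
(`val_le_val_sum`). Over all other points, including ∞, y is regular and the cover is étale. The
conjugates y + j then recover the coefficients by Lagrange interpolation, whose denominators are
nonzero constants (`val_coeff_le_of_eval`).

Differentials are handled through their coefficient of dx. Locally g dx is regular exactly when g is
regular at unramified finite points, when g x² is regular above ∞, and when v(g)^p v(x -
ρ_i)^((p-1)(l_i+1)) ≤ 1 above ρ_i (`mem_differentials_of_ne`, `mem_differentials_of_infty`,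
`mem_differentials_of_eq`).

Rounding these conditions to integers produces the exponents m_i. Functions on U_0 ∩ U_∞ have the
basis x^j g_{p-1-μ} y^μ with j in ℤ. Those with j ≥ 0 span the functions on U_∞, those with j ≤
-t^{(p-1-μ)} the functions on U_0, and the gap between gives H¹(X, 𝒪). Global differentials have the
basis x^j y^μ / g_μ dx with 0 ≤ j ≤ t^{(μ)} - 2. Finally d`h̃` is computed from dy, and cutting φ
and ψ by degree splits it into a part regular on U_0 and a part regular on U_∞ (`D_hTilde`,
`aTriple_mem`). -/

theorem Valuation.le_sum_of_pairwise_ne {K Γ ι : Type*} [Field K]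
    [LinearOrderedCommGroupWithZero Γ] (v : Valuation K Γ) (s : Finset ι) (a : ι → K)
    (h : ∀ i ∈ s, ∀ j ∈ s, i ≠ j → a i ≠ 0 → a j ≠ 0 → v (a i) ≠ v (a j)) :
    ∀ i ∈ s, v (a i) ≤ v (∑ j ∈ s, a j) := by
  classical
  intro i hi
  obtain ⟨m, hm, hmax⟩ := s.exists_max_image (fun j => v (a j)) ⟨i, hi⟩
  by_cases hm0 : a m = 0
  · have := hmax i hi
    rw [hm0, map_zero] at this
    exact this.trans zero_le
  refine (hmax i hi).trans (le_of_eq ?_)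
  rw [← Finset.add_sum_erase s a hm]
  refine (v.map_add_eq_of_lt_left ?_).symm
  refine v.map_sum_lt ((v.ne_zero_iff).2 hm0) fun j hj => ?_
  obtain ⟨hjm, hjs⟩ := Finset.mem_erase.1 hj
  by_cases hj0 : a j = 0
  · rw [hj0, map_zero]
    exact zero_lt_iff.2 ((v.ne_zero_iff).2 hm0)
  · exact lt_of_le_of_ne (hmax j hjs) (h j hjs m hm hjm hj0 hm0)

namespace CurvePoint

variable {k F : Type*} [Field k] [Field F] [Algebra k F]

/-- The valuation of the function field at a point. -/
noncomputable abbrev val (P : CurvePoint k F) : Valuation F P.localRing.ValueGroup := P.localRing.valuation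

variable (P : CurvePoint k F)

theorem val_le_one_iff {f : F} : P.val f ≤ 1 ↔ f ∈ P.localRing :=
  P.localRing.valuation_le_one_iff f

theorem val_algebraMap_le (c : k) : P.val (algebraMap k F c) ≤ 1 :=
  P.val_le_one_iff.2 (P.algebraMap_mem c)

theorem val_algebraMap {c : k} (hc : c ≠ 0) : P.val (algebraMap k F c) = 1 := by
  refine le_antisymm (P.val_algebraMap_le c) ?_
  have h := P.val_algebraMap_le c⁻¹
  rw [map_inv₀, map_inv₀] at h
  exact (inv_le_one₀ (zero_lt_iff.2 (by simpa using hc))).1 h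

theorem val_natCast_le (n : ℕ) : P.val (n : F) ≤ 1 := by
  have := P.val_algebraMap_le (n : k)
  rwa [map_natCast] at this

theorem val_aeval_le {x : F} (hx : P.val x ≤ 1) (q : k[X]) : P.val (aeval x q) ≤ 1 := by
  rw [aeval_eq_sum_range]
  refine P.val.map_sum_le fun i _ => ?_
  rw [Algebra.smul_def, map_mul, map_pow]
  exact mul_le_one' (P.val_algebraMap_le _) (pow_le_one' hx _)

theorem val_le_one_of_val_sub_lt {x : F} {c : k} (h : P.val (x - algebraMap k F c) < 1) :
    P.val x ≤ 1 := by
  have := P.val.map_add (x - algebraMap k F c) (algebraMap k F c)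
  rw [sub_add_cancel] at this
  exact this.trans (max_le h.le (P.val_algebraMap_le c))

theorem val_aeval_eq_one {x : F} {c : k} (h : P.val (x - algebraMap k F c) < 1) {q : k[X]}
    (hq : q.eval c ≠ 0) : P.val (aeval x q) = 1 := by
  obtain ⟨w, hw⟩ := X_sub_C_dvd_sub_C_eval (p := q) (a := c)
  have e : aeval x q = (x - algebraMap k F c) * aeval x w + algebraMap k F (q.eval c) := by
    have := congrArg (aeval x) (sub_eq_iff_eq_add.1 hw)
    simpa using this
  rw [e, P.val.map_add_eq_of_lt_right, P.val_algebraMap hq]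
  rw [P.val_algebraMap hq, map_mul]
  exact mul_lt_one_of_lt_of_le h (P.val_aeval_le (P.val_le_one_of_val_sub_lt h) w)

theorem val_aeval_eq_pow {x : F} {c : k} (h : P.val (x - algebraMap k F c) < 1) {q : k[X]}
    (hq : q ≠ 0) : P.val (aeval x q) = P.val (x - algebraMap k F c) ^ q.rootMultiplicity c := by
  obtain ⟨w, hw, hd⟩ := exists_eq_pow_rootMultiplicity_mul_and_not_dvd q hq c
  conv_lhs => rw [hw]
  rw [map_mul, map_mul, P.val_aeval_eq_one h (q := w), mul_one]
  · simp
  · rwa [dvd_iff_isRoot] at hd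

/-- The reversed polynomial at x⁻¹ is a unit, since its constant coefficient is the leading
coefficient of `q`. -/
theorem val_aeval_eq_pow_natDegree {x : F} (hx : 1 < P.val x) {q : k[X]} (hq : q ≠ 0) :
    P.val (aeval x q) = P.val x ^ q.natDegree := by
  have hx0 : x ≠ 0 := by rintro rfl; simp at hx
  let := invertibleOfNonzero hx0
  have e := eval₂_reverse_mul_pow (algebraMap k F) x q
  rw [← aeval_def, ← aeval_def, invOf_eq_inv] at e
  rw [← e, map_mul, map_pow]
  have : P.val (aeval x⁻¹ q.reverse) = 1 := by
    refine P.val_aeval_eq_one (c := 0) ?_ ?_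
    · rw [map_zero, sub_zero, map_inv₀]
      exact (inv_lt_one₀ (zero_lt_one.trans hx)).2 hx
    · rw [← coeff_zero_eq_eval_zero, coeff_zero_reverse]
      simpa using hq
  rw [this, one_mul]

theorem exists_val_eq_zpow {x : F} {c : k} (hx : x - algebraMap k F c ≠ 0)
    (h : P.val (x - algebraMap k F c) < 1) {a : F}
    (ha : a ∈ IntermediateField.adjoin k {x}) (ha0 : a ≠ 0) :
    ∃ e : ℤ, P.val a = P.val (x - algebraMap k F c) ^ e := by
  obtain ⟨n, d, rfl⟩ := IntermediateField.mem_adjoin_simple_iff k a |>.1 ha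
  have hn : n ≠ 0 := by rintro rfl; simp at ha0
  have hd : d ≠ 0 := by rintro rfl; simp at ha0
  refine ⟨(n.rootMultiplicity c : ℤ) - d.rootMultiplicity c, ?_⟩
  rw [map_div₀, P.val_aeval_eq_pow h hn, P.val_aeval_eq_pow h hd,
    zpow_sub₀ ((P.val.ne_zero_iff).2 hx)]
  simp

/-- Over an algebraically closed field `q` splits; were every y - β a unit, the value of `q` at y
would be one too. -/
theorem exists_val_sub_lt [IsAlgClosed k] {y : F} (hy : P.val y ≤ 1)
    {q : k[X]} (hq : q ≠ 0) (h : P.val (aeval y q) < 1) :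
    ∃ β : k, P.val (y - algebraMap k F β) < 1 := by
  by_contra! h0
  have h1 : ∀ c : k, P.val (y - algebraMap k F c) = 1 := fun c => le_antisymm
    (P.val_le_one_iff.2 (sub_mem (P.val_le_one_iff.1 hy) (P.algebraMap_mem c))) (h0 c)
  rw [(IsAlgClosed.splits q).eq_prod_roots, map_mul, map_mul, aeval_C,
    P.val_algebraMap (leadingCoeff_ne_zero.2 hq), one_mul, map_multiset_prod,
    map_multiset_prod] at h
  simp [h1] at h

/-- A point at which `u` vanishes, for `u` transcendental. -/
theorem exists_val_lt_one {u : F} (hu : Transcendental k u) :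
    ∃ P : CurvePoint k F, P.val u < 1 := by
  let A : Subring F := (aeval u : k[X] →ₐ[k] F).range.toSubring
  have hmem : ∀ q : k[X], aeval u q ∈ A := fun q => ⟨q, rfl⟩
  have huA : u ∈ A := by simpa using hmem X
  have hI : Ideal.span {(⟨u, huA⟩ : A)} ≠ ⊤ := by
    intro h
    rw [Ideal.span_singleton_eq_top, isUnit_iff_exists_inv] at h
    obtain ⟨⟨_, q, rfl⟩, hq⟩ := h
    have hq' : u * aeval u q = 1 := congrArg Subtype.val hq
    refine hu ⟨X * q - 1, fun h0 => ?_, by simp [hq']⟩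
    simpa using congrArg (eval 0) h0
  -- A proper ideal of a subring of a field lies in the nonunits of some valuation ring containing
  -- the subring. Here the ring is k[u], in which u is not invertible.
  obtain ⟨B, hAB, hB⟩ := Ideal.image_subset_nonunits_valuationSubring _ hI
  have huB : u ∈ B.nonunits := hB ⟨_, Ideal.subset_span rfl, rfl⟩
  refine ⟨⟨B, fun c => hAB ?_, ?_⟩, huB⟩
  · simpa using hmem (C c)
  · rintro rfl
    rw [ValuationSubring.mem_nonunits_iff_or] at huB
    rcases huB with rfl | h
    · exact hu isAlgebraic_zero
    · exact h (ValuationSubring.mem_top _)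

end CurvePoint

/-! ### Artin–Schreier covers of the projective line -/

namespace ArtinSchreier

variable {k F : Type*} [Field k] [Field F] [Algebra k F] {r : ℕ}

/-- `F = k(x, y)` with `y ^ p - y = f(x) / ∏ i, (x - ρ_i) ^ l_i`, where `x` is transcendental, the
fraction is reduced, unramified above infinity, and has poles of orders prime to `p`. -/
structure IsCover (p : ℕ) (ρ : Fin r → k) (l : Fin r → ℕ) (f : k[X]) (x y : F) : Prop where
  prime : p.Prime
  three_le : 3 ≤ p
  pos : 1 ≤ r
  injective : Function.Injective ρ
  one_le : ∀ i, 1 ≤ l i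
  coprime : ∀ i, (l i).Coprime p
  isCoprime : IsCoprime f (∏ i, (X - C (ρ i)) ^ l i)
  natDegree_eq : f.natDegree = ∑ i, l i
  transcendental : Transcendental k x
  adjoin_eq_top : IntermediateField.adjoin k {x, y} = ⊤
  equation : y ^ p - y = aeval x f / aeval x (∏ i, (X - C (ρ i)) ^ l i)

/-! #### Valuations of products of powers of the `x - ρ_i` -/

theorem val_aeval_prod_of_eq (P : CurvePoint k F) {ρ : Fin r → k} (hρ : Function.Injective ρ)
    {x : F} {i : Fin r} (h : P.val (x - algebraMap k F (ρ i)) < 1) (n : Fin r → ℕ) :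
    P.val (aeval x (∏ j, (X - C (ρ j)) ^ n j)) = P.val (x - algebraMap k F (ρ i)) ^ n i := by
  rw [← Finset.mul_prod_erase _ _ (Finset.mem_univ i), map_mul, map_mul,
    P.val_aeval_eq_one h (q := ∏ j ∈ Finset.univ.erase i, (X - C (ρ j)) ^ n j), mul_one]
  · simp
  · rw [eval_prod, Finset.prod_ne_zero_iff]
    intro j hj
    simpa [sub_eq_zero] using fun h0 => absurd (hρ h0).symm (Finset.ne_of_mem_erase hj)

theorem val_aeval_prod_of_ne (P : CurvePoint k F) {ρ : Fin r → k} {x : F} {c : k}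
    (h : P.val (x - algebraMap k F c) < 1) (hc : ∀ i, ρ i ≠ c) (n : Fin r → ℕ) :
    P.val (aeval x (∏ j, (X - C (ρ j)) ^ n j)) = 1 := by
  refine P.val_aeval_eq_one h ?_
  rw [eval_prod, Finset.prod_ne_zero_iff]
  intro j hj
  simpa [sub_eq_zero] using fun h0 => absurd h0.symm (hc j)

theorem prod_monic (ρ : Fin r → k) (n : Fin r → ℕ) : (∏ j, (X - C (ρ j)) ^ n j).Monic :=
  monic_prod_of_monic _ _ fun j _ => (monic_X_sub_C _).pow _

theorem natDegree_prod_sub_pow (ρ : Fin r → k) (n : Fin r → ℕ) :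
    (∏ j, (X - C (ρ j)) ^ n j).natDegree = ∑ j, n j := by
  rw [natDegree_prod_of_monic _ _ fun j _ => (monic_X_sub_C _).pow _]
  simp

namespace IsCover

variable {p : ℕ} {ρ : Fin r → k} {l : Fin r → ℕ} {f : k[X]} {x y : F}

theorem sub_ne_zero (H : IsCover p ρ l f x y) (c : k) : x - algebraMap k F c ≠ 0 := by
  intro h
  rw [sub_eq_zero] at h
  exact H.transcendental (h ▸ isAlgebraic_algebraMap c)

theorem aeval_ne_zero (H : IsCover p ρ l f x y) {q : k[X]} (hq : q ≠ 0) : aeval x q ≠ 0 :=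
  fun h => H.transcendental ⟨q, hq, h⟩

theorem transcendental_sub (H : IsCover p ρ l f x y) (c : k) :
    Transcendental k (x - algebraMap k F c) := by
  intro h
  have := h.add (isAlgebraic_algebraMap c)
  rw [sub_add_cancel] at this
  exact H.transcendental this

theorem transcendental_inv (H : IsCover p ρ l f x y) : Transcendental k x⁻¹ :=
  fun h => H.transcendental (by simpa using h.inv)

theorem ne_zero (H : IsCover p ρ l f x y) : x ≠ 0 := by
  simpa using H.sub_ne_zero 0

theorem f_ne_zero (H : IsCover p ρ l f x y) : f ≠ 0 := by
  rintro rfl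
  have h := H.natDegree_eq
  have := Finset.sum_le_sum fun i (_ : i ∈ Finset.univ) => H.one_le i
  have := H.pos
  simp at *
  omega

theorem eval_f_ne_zero (H : IsCover p ρ l f x y) (i : Fin r) : f.eval (ρ i) ≠ 0 := by
  intro h
  obtain ⟨a, b, hab⟩ := H.isCoprime
  have := congrArg (eval (ρ i)) hab
  have h0 : eval (ρ i) (∏ i, (X - C (ρ i)) ^ l i) = 0 := by
    rw [eval_prod]
    refine Finset.prod_eq_zero (Finset.mem_univ i) ?_
    have := H.one_le i
    simp
    omega
  simp [h, h0] at this

theorem self_mem (_ : IsCover p ρ l f x y) : x ∈ IntermediateField.adjoin k {x} :=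
  IntermediateField.mem_adjoin_simple_self k x

theorem aeval_mem (H : IsCover p ρ l f x y) (q : k[X]) :
    aeval x q ∈ IntermediateField.adjoin k {x} := by
  rw [aeval_eq_sum_range]
  exact sum_mem fun i _ => IntermediateField.smul_mem _ (pow_mem H.self_mem i)

/-- The right-hand side of the Artin–Schreier equation. -/
theorem equation_mem (H : IsCover p ρ l f x y) : y ^ p - y ∈ IntermediateField.adjoin k {x} := by
  rw [H.equation]
  exact div_mem (H.aeval_mem _) (H.aeval_mem _)

/-- The Artin–Schreier polynomial over `k(x)`. -/
noncomputable def poly (H : IsCover p ρ l f x y) : (IntermediateField.adjoin k {x})[X] :=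
  X ^ p - X - C ⟨y ^ p - y, H.equation_mem⟩

theorem poly_natDegree (H : IsCover p ρ l f x y) : H.poly.natDegree = p := by
  have := H.three_le
  rw [poly, natDegree_sub_C, natDegree_sub_eq_left_of_natDegree_lt]
  · simp
  · simp
    omega

theorem poly_monic (H : IsCover p ρ l f x y) : H.poly.Monic := by
  have := H.three_le
  rw [poly, sub_sub]
  refine monic_X_pow_sub ?_
  rw [degree_X_add_C]
  exact_mod_cast (by omega : 1 < p)

theorem aeval_poly (H : IsCover p ρ l f x y) : aeval y H.poly = 0 := by
  simp [poly]

theorem adjoin_y (H : IsCover p ρ l f x y) :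
    IntermediateField.adjoin (IntermediateField.adjoin k {x}) {y} = ⊤ := by
  have := IntermediateField.adjoin_simple_adjoin_simple k x y
  rw [H.adjoin_eq_top] at this
  exact IntermediateField.restrictScalars_injective k this

/-- Division with remainder by the monic Artin–Schreier polynomial. Its irreducibility is not needed
here and is obtained only later, from valuations. -/
theorem exists_sum (H : IsCover p ρ l f x y) (h : F) :
    ∃ a : ℕ → F, (∀ μ, a μ ∈ IntermediateField.adjoin k {x}) ∧
      h = ∑ μ ∈ Finset.range p, a μ * y ^ μ := by
  have hint : IsIntegral (IntermediateField.adjoin k {x}) y := ⟨_, H.poly_monic, H.aeval_poly⟩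
  have hh : h ∈ (IntermediateField.adjoin (IntermediateField.adjoin k {x}) {y}).toSubalgebra := by
    rw [H.adjoin_y]; trivial
  rw [IntermediateField.adjoin_simple_toSubalgebra_of_isAlgebraic hint.isAlgebraic,
    Algebra.adjoin_singleton_eq_range_aeval] at hh
  obtain ⟨s, rfl⟩ := hh
  refine ⟨fun μ => ((s %ₘ H.poly).coeff μ : F), fun μ => SetLike.coe_mem _, ?_⟩
  have e : aeval y s = aeval y (s %ₘ H.poly) := by
    conv_lhs => rw [← modByMonic_add_div s H.poly]
    simp [H.aeval_poly]
  have hd : (s %ₘ H.poly).natDegree < p := by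
    have := natDegree_modByMonic_lt s H.poly_monic
      (by intro h1; have := H.poly_natDegree; have := H.three_le; simp [h1] at *; omega)
    rwa [H.poly_natDegree] at this
  change aeval y s = _
  rw [e, aeval_eq_sum_range' hd]
  rfl

/-! #### The points of the curve -/

/-- At a pole of y the term y^p would dominate y^p - y. -/
theorem y_mem_of_mem (H : IsCover p ρ l f x y) (P : CurvePoint k F)
    (h : y ^ p - y ∈ P.localRing) : P.val y ≤ 1 := by
  by_contra! hy
  have hp : 1 < p := H.prime.one_lt
  rw [← P.val_le_one_iff, P.val.map_sub_eq_of_lt_left, map_pow] at h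
  · exact absurd h (not_le.2 (one_lt_pow₀ hy (by omega)))
  · rw [map_pow]
    exact lt_self_pow₀ hy hp

/-- A valuation ring containing k(x) also contains y, which is integral over k(x), and hence all of
F. -/
theorem exists_not_mem (H : IsCover p ρ l f x y) (P : CurvePoint k F) :
    ∃ a ∈ IntermediateField.adjoin k {x}, a ∉ P.localRing := by
  by_contra! h
  refine P.ne_top (eq_top_iff.2 fun z _ => ?_)
  obtain ⟨a, ha, rfl⟩ := H.exists_sum z
  have hy := P.val_le_one_iff.1 (H.y_mem_of_mem P (h _ H.equation_mem))
  exact sum_mem fun μ _ => mul_mem (h _ (ha μ)) (pow_mem hy μ)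

/-- If no x - c vanished at P, all nonzero polynomials in x would be units there, and k(x) would lie
in the local ring. -/
theorem exists_center [IsAlgClosed k] (H : IsCover p ρ l f x y) (P : CurvePoint k F)
    (hx : x ∈ P.localRing) : ∃ c : k, P.val (x - algebraMap k F c) < 1 := by
  by_contra! h
  have hx' := P.val_le_one_iff.2 hx
  have h2 : ∀ q : k[X], q ≠ 0 → P.val (aeval x q) = 1 := fun q hq =>
    le_antisymm (P.val_aeval_le hx' q) (not_lt.1 fun hlt =>
      have ⟨c, hc⟩ := P.exists_val_sub_lt hx' hq hlt
      (h c).not_gt hc)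
  obtain ⟨a, ha, ha'⟩ := H.exists_not_mem P
  refine ha' (P.val_le_one_iff.1 ?_)
  obtain ⟨n, d, rfl⟩ := IntermediateField.mem_adjoin_simple_iff k a |>.1 ha
  by_cases hn : n = 0
  · simp [hn]
  by_cases hd : d = 0
  · simp [hd]
  · simp [h2 _ hn, h2 _ hd]

/-- The right-hand side has a pole at P because f(ρ_i) ≠ 0. This forces a pole of y, and then y^p
dominates y. -/
theorem val_y_of_eq (H : IsCover p ρ l f x y) (P : CurvePoint k F) {i : Fin r}
    (h : P.val (x - algebraMap k F (ρ i)) < 1) :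
    P.val y ^ p * P.val (x - algebraMap k F (ρ i)) ^ l i = 1 := by
  have hne : P.val (x - algebraMap k F (ρ i)) ≠ 0 := (P.val.ne_zero_iff).2 (H.sub_ne_zero _)
  have e : P.val (y ^ p - y) * P.val (x - algebraMap k F (ρ i)) ^ l i = 1 := by
    rw [H.equation, map_div₀, P.val_aeval_eq_one h (H.eval_f_ne_zero i),
      val_aeval_prod_of_eq P H.injective h, div_mul_cancel₀]
    exact pow_ne_zero _ hne
  have hy : 1 < P.val y := by
    by_contra! hy
    have h1 : P.val (y ^ p - y) ≤ 1 := P.val_le_one_iff.2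
      (sub_mem (pow_mem (P.val_le_one_iff.1 hy) _) (P.val_le_one_iff.1 hy))
    have h2 : P.val (x - algebraMap k F (ρ i)) ^ l i < 1 :=
      pow_lt_one₀ zero_le h (by have := H.one_le i; omega)
    exact absurd e ((mul_le_of_le_one_left' h1).trans_lt h2).ne
  rw [P.val.map_sub_eq_of_lt_left, map_pow] at e
  · exact e
  · rw [map_pow]
    exact lt_self_pow₀ hy H.prime.one_lt

theorem equation_mem_of_ne (H : IsCover p ρ l f x y) (P : CurvePoint k F) {c : k}
    (h : P.val (x - algebraMap k F c) < 1) (hc : ∀ i, ρ i ≠ c) : y ^ p - y ∈ P.localRing := by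
  rw [← P.val_le_one_iff, H.equation, map_div₀, val_aeval_prod_of_ne P h hc, div_one]
  exact P.val_aeval_le (P.val_le_one_of_val_sub_lt h) _

theorem equation_mem_of_infty (H : IsCover p ρ l f x y) (P : CurvePoint k F)
    (h : 1 < P.val x) : y ^ p - y ∈ P.localRing := by
  rw [← P.val_le_one_iff, H.equation, map_div₀, P.val_aeval_eq_pow_natDegree h H.f_ne_zero,
    P.val_aeval_eq_pow_natDegree h (prod_monic ρ l).ne_zero, natDegree_prod_sub_pow,
    H.natDegree_eq, div_self]
  exact pow_ne_zero _ (zero_lt_one.trans h).ne'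

theorem val_mul_pow_of_eq (H : IsCover p ρ l f x y) (P : CurvePoint k F) {i : Fin r}
    (h : P.val (x - algebraMap k F (ρ i)) < 1) {a : F} {e : ℤ}
    (ha : P.val a = P.val (x - algebraMap k F (ρ i)) ^ e) (μ : ℕ) :
    P.val (a * y ^ μ) ^ p = P.val (x - algebraMap k F (ρ i)) ^ (p * e - l i * μ : ℤ) := by
  have hne : P.val (x - algebraMap k F (ρ i)) ≠ 0 := (P.val.ne_zero_iff).2 (H.sub_ne_zero _)
  have hy : P.val y ^ p = P.val (x - algebraMap k F (ρ i)) ^ (-(l i : ℤ)) := by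
    rw [zpow_neg, zpow_natCast]
    exact eq_inv_of_mul_eq_one_left (H.val_y_of_eq P h)
  rw [map_mul, map_pow, mul_pow, ← pow_mul, mul_comm μ p, pow_mul, hy, ha, ← zpow_natCast,
    ← zpow_mul, ← zpow_natCast, ← zpow_mul, ← zpow_add₀ hne]
  congr 1
  ring

theorem zpow_inj (H : IsCover p ρ l f x y) (P : CurvePoint k F) {c : k}
    (h : P.val (x - algebraMap k F c) < 1) {m n : ℤ}
    (e : P.val (x - algebraMap k F c) ^ m = P.val (x - algebraMap k F c) ^ n) : m = n :=
  zpow_right_injective₀ (zero_lt_iff.2 ((P.val.ne_zero_iff).2 (H.sub_ne_zero _))) h.ne e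

theorem not_dvd_mul (H : IsCover p ρ l f x y) (i : Fin r) {n : ℤ} (hn : n ≠ 0) (hnp : |n| < p) :
    ¬ (p : ℤ) ∣ l i * n := by
  intro h
  have h1 : IsCoprime (p : ℤ) (l i) := (Nat.isCoprime_iff_coprime.2 (H.coprime i)).symm
  exact hn (Int.eq_zero_of_abs_lt_dvd (h1.dvd_of_dvd_mul_left h) hnp)

/-- The p-th powers of the values are powers of v(x - ρ_i) with exponents p e - l_i μ, which are
pairwise incongruent modulo p for μ < p. Hence no cancellation is possible at a ramified point. -/
theorem val_le_val_sum (H : IsCover p ρ l f x y) (P : CurvePoint k F) {i : Fin r}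
    (h : P.val (x - algebraMap k F (ρ i)) < 1) {a : ℕ → F}
    (ha : ∀ μ, a μ ∈ IntermediateField.adjoin k {x}) {μ : ℕ} (hμ : μ < p) :
    P.val (a μ * y ^ μ) ≤ P.val (∑ μ ∈ Finset.range p, a μ * y ^ μ) := by
  refine P.val.le_sum_of_pairwise_ne _ (fun μ => a μ * y ^ μ) ?_ μ (Finset.mem_range.2 hμ)
  intro μ hμ ν hν hne h1 h2 e
  obtain ⟨e1, he1⟩ := P.exists_val_eq_zpow (H.sub_ne_zero _) h (ha μ) (left_ne_zero_of_mul h1)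
  obtain ⟨e2, he2⟩ := P.exists_val_eq_zpow (H.sub_ne_zero _) h (ha ν) (left_ne_zero_of_mul h2)
  have := congrArg (· ^ p) e
  simp only [H.val_mul_pow_of_eq P h he1, H.val_mul_pow_of_eq P h he2] at this
  have := H.zpow_inj P h this
  rw [Finset.mem_range] at hμ hν
  refine H.not_dvd_mul i (n := μ - ν) (by omega) (by rw [abs_lt]; omega) ⟨e1 - e2, ?_⟩
  linear_combination -this

theorem exists_point (H : IsCover p ρ l f x y) (c : k) :
    ∃ P : CurvePoint k F, P.val (x - algebraMap k F c) < 1 :=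
  CurvePoint.exists_val_lt_one (H.transcendental_sub c)

theorem exists_point_infty (H : IsCover p ρ l f x y) : ∃ P : CurvePoint k F, 1 < P.val x := by
  obtain ⟨P, hP⟩ := CurvePoint.exists_val_lt_one H.transcendental_inv
  rw [map_inv₀] at hP
  exact ⟨P, (inv_lt_one₀ (zero_lt_iff.2 ((P.val.ne_zero_iff).2 H.ne_zero))).1 hP⟩

/-- Independence of the powers of y is read off at one ramified point, which exists since r ≥ 1. The
irreducibility of the Artin–Schreier polynomial follows. -/
theorem eq_zero_of_sum_eq_zero (H : IsCover p ρ l f x y) {a : ℕ → F}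
    (ha : ∀ μ, a μ ∈ IntermediateField.adjoin k {x})
    (h : ∑ μ ∈ Finset.range p, a μ * y ^ μ = 0) {μ : ℕ} (hμ : μ < p) : a μ = 0 := by
  obtain ⟨P, hP⟩ := H.exists_point (ρ ⟨0, H.pos⟩)
  have h1 := H.val_le_val_sum P hP ha hμ
  rw [h, map_zero, le_zero_iff, P.val.zero_iff] at h1
  refine (mul_eq_zero.1 h1).resolve_right (pow_ne_zero _ ?_)
  rintro rfl
  have := H.val_y_of_eq P hP
  simp [H.prime.ne_zero] at this

/-! #### The Galois group -/

theorem minpoly_eq (H : IsCover p ρ l f x y) :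
    minpoly (IntermediateField.adjoin k {x}) y = H.poly := by
  refine (minpoly.unique' _ _ H.poly_monic H.aeval_poly fun q hq => ?_).symm
  by_contra! h
  rw [degree_eq_natDegree H.poly_monic.ne_zero, H.poly_natDegree] at hq
  have hd := (natDegree_lt_iff_degree_lt h.1).2 hq
  refine h.1 (Polynomial.ext fun μ => ?_)
  by_cases hμ : μ < p
  · have := h.2
    rw [aeval_eq_sum_range' hd] at this
    exact Subtype.ext (H.eq_zero_of_sum_eq_zero (a := fun μ => (q.coeff μ : F))
      (fun μ => SetLike.coe_mem _) this hμ)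
  · exact coeff_eq_zero_of_natDegree_lt (by omega)

theorem exists_algHom [CharP k p] (H : IsCover p ρ l f x y) (j : ℕ) :
    ∃ σ : F →ₐ[IntermediateField.adjoin k {x}] F, σ y = y + j := by
  have hint : IsIntegral (IntermediateField.adjoin k {x}) y := ⟨_, H.poly_monic, H.aeval_poly⟩
  have := Fact.mk H.prime
  have : CharP F p := (Algebra.charP_iff k F p).1 inferInstance
  let pb := (IntermediateField.adjoin.powerBasis hint).map
    ((IntermediateField.equivOfEq H.adjoin_y).trans IntermediateField.topEquiv)
  have hpb : pb.gen = y := by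
    simp [pb]
  refine ⟨pb.lift (y + j) ?_, ?_⟩
  · rw [hpb, H.minpoly_eq, poly]
    have e : ((j : F)) ^ p = j := by
      rw [← frobenius_def, map_natCast]
    simp only [map_sub, map_pow, aeval_X, aeval_C, add_pow_char, e]
    change y ^ p + j - (y + j) - (y ^ p - y) = 0
    ring
  · exact (congrArg _ hpb.symm).trans (pb.lift_gen _ _)

end IsCover

/-- At a point where `y` is regular, a polynomial of degree `< p` which takes regular values at the
translates of `y` by the elements of the prime field has regular coefficients. -/
theorem val_coeff_le_of_eval {p : ℕ} [CharP k p] (P : CurvePoint k F)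
    {y : F} (hy : P.val y ≤ 1) {q : F[X]} (hq : q.natDegree < p)
    (h : ∀ j < p, P.val (q.eval (y + j)) ≤ 1) (n : ℕ) : P.val (q.coeff n) ≤ 1 := by
  have : CharP F p := (Algebra.charP_iff k F p).1 inferInstance
  let φ : P.localRing →+* F := P.localRing.subtype
  have hC : ∀ z : F, P.val z ≤ 1 → C z ∈ lifts φ := fun z hz =>
    C'_mem_lifts ⟨⟨z, P.val_le_one_iff.1 hz⟩, rfl⟩
  have hinj : Set.InjOn (fun j : ℕ => (j : F)) (Finset.range p) := by
    intro i hi j hj e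
    simp only [Finset.coe_range, Set.mem_Iio] at hi hj
    exact Nat.ModEq.eq_of_lt_of_lt ((CharP.natCast_eq_natCast F p).1 e) hi hj
  have h1 : q.comp (X + C y) ∈ lifts φ := by
    have hd : (q.comp (X + C y)).degree < (Finset.range p).card := by
      refine degree_le_natDegree.trans_lt ?_
      rw [natDegree_comp, natDegree_X_add_C, mul_one, Finset.card_range]
      exact_mod_cast hq
    -- The nodes 0, …, p - 1 differ by nonzero constants, so interpolating q(X + y) there introduces
    -- no denominators; translating back by the regular function y is harmless.
    rw [Lagrange.eq_interpolate hinj hd, Lagrange.interpolate_apply]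
    refine sum_mem fun j hj => mul_mem (hC _ ?_) (prod_mem fun i hi => mul_mem (hC _ ?_) ?_)
    · rw [eval_comp]
      simpa [add_comm] using h j (Finset.mem_range.1 hj)
    · have := P.val_algebraMap_le ((j : k) - i)⁻¹
      simpa using this
    · rw [sub_eq_add_neg, ← C_neg]
      refine add_mem (X_mem_lifts φ) (hC _ ?_)
      rw [Valuation.map_neg]
      exact P.val_natCast_le i
  obtain ⟨w, hw⟩ := (mem_lifts _).1 h1
  have h2 : q = (w.comp (X - C ⟨y, P.val_le_one_iff.1 hy⟩)).map φ := by
    rw [Polynomial.map_comp, hw, comp_assoc]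
    simp [φ]
  rw [h2, coeff_map]
  exact P.val_le_one_iff.2 (SetLike.coe_mem _)

namespace IsCover

variable {p : ℕ} {ρ : Fin r → k} {l : Fin r → ℕ} {f : k[X]} {x y : F}

/-- Regularity of a conjugate at P becomes regularity of the function itself at a conjugate point of
the same fibre. The pulled-back ring is proper because σ fixes an element of k(x) that is not
regular at P. -/
theorem exists_conj [CharP k p] (H : IsCover p ρ l f x y) (P : CurvePoint k F) (j : ℕ) :
    ∃ (σ : F →ₐ[IntermediateField.adjoin k {x}] F) (P' : CurvePoint k F), σ y = y + j ∧
      ∀ z, z ∈ P'.localRing ↔ σ z ∈ P.localRing := by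
  obtain ⟨σ, hσ⟩ := H.exists_algHom j
  obtain ⟨a, ha, ha'⟩ := H.exists_not_mem P
  refine ⟨σ, ⟨P.localRing.comap (σ : F →+* F), fun c => ?_, fun h => ha' ?_⟩, hσ, fun z => Iff.rfl⟩
  · have : (σ : F →+* F) (algebraMap k F c) = algebraMap k F c :=
      σ.commutes (algebraMap k (IntermediateField.adjoin k {x}) c)
    rw [ValuationSubring.mem_comap, this]
    exact P.algebraMap_mem c
  · have h1 : a ∈ P.localRing.comap (σ : F →+* F) := by rw [h]; trivial
    have : (σ : F →+* F) a = a := σ.commutes ⟨a, ha⟩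
    rwa [ValuationSubring.mem_comap, this] at h1

/-- The coefficients of a function which is regular at all points of an unramified fibre are
regular there. -/
theorem val_coeff_le [CharP k p] (H : IsCover p ρ l f x y) (P : CurvePoint k F)
    (hy : P.val y ≤ 1) {a : ℕ → F} (ha : ∀ μ, a μ ∈ IntermediateField.adjoin k {x})
    (h : ∀ P' : CurvePoint k F,
      (∀ z ∈ IntermediateField.adjoin k {x}, z ∈ P'.localRing ↔ z ∈ P.localRing) →
      ∑ μ ∈ Finset.range p, a μ * y ^ μ ∈ P'.localRing) {μ : ℕ} (hμ : μ < p) :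
    P.val (a μ) ≤ 1 := by
  have key := val_coeff_le_of_eval (p := p) P hy (q := ∑ μ ∈ Finset.range p, monomial μ (a μ)) ?_ ?_ μ
  · rwa [finsetSum_coeff, Finset.sum_eq_single μ, coeff_monomial, if_pos rfl] at key
    · intro ν _ hν
      rw [coeff_monomial, if_neg hν]
    · exact fun h => absurd (Finset.mem_range.2 hμ) h
  · refine (natDegree_sum_le_of_forall_le (n := p - 1) _ _ fun ν hν => ?_).trans_lt
      (Nat.sub_lt H.prime.pos one_pos)
    exact (natDegree_monomial_le _).trans (Nat.le_sub_one_of_lt (Finset.mem_range.1 hν))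
  · intro j _
    -- The value of the coefficient polynomial at y + j is the conjugate of the given sum, hence
    -- regular.
    obtain ⟨σ, P', hσ, hP'⟩ := H.exists_conj P j
    have h0 : ∀ z ∈ IntermediateField.adjoin k {x}, σ z = z := fun z hz => σ.commutes ⟨z, hz⟩
    have h1 := (hP' _).1 (h P' fun z hz => by rw [hP', h0 z hz])
    rw [P.val_le_one_iff]
    convert h1 using 1
    rw [map_sum, eval_finsetSum]
    refine Finset.sum_congr rfl fun ν _ => ?_
    rw [eval_monomial, map_mul, map_pow, hσ, h0 _ (ha ν)]

/-! #### Differentials -/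

theorem isSeparable [CharP k p] (H : IsCover p ρ l f x y) :
    Algebra.IsSeparable (IntermediateField.adjoin k {x}) F := by
  have hs : IsSeparable (IntermediateField.adjoin k {x}) y := by
    rw [IsSeparable, H.minpoly_eq, poly, separable_def]
    have : CharP (IntermediateField.adjoin k {x}) p := (Algebra.charP_iff k _ p).1 inferInstance
    -- The derivative of Y^p - Y - c is -1, which gives the Bézout relation.
    refine ⟨0, -1, ?_⟩
    simp [derivative_X_pow, CharP.cast_eq_zero]
  have h1 : Algebra.IsSeparable (IntermediateField.adjoin k {x})
      (IntermediateField.adjoin (IntermediateField.adjoin k {x}) {y}) :=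
    (IntermediateField.isSeparable_adjoin_simple_iff_isSeparable _ _).2 hs
  exact AlgEquiv.Algebra.isSeparable
    ((IntermediateField.equivOfEq H.adjoin_y).trans IntermediateField.topEquiv)

/-- The differentials of the function field are a line, generated by `dx`. -/
theorem exists_equiv [CharP k p] (H : IsCover p ρ l f x y) :
    ∃ e : Ω[F⁄k] ≃ₗ[F] F, e (KaehlerDifferential.D k F x) = 1 := by
  have hsep := H.isSeparable
  let K := IntermediateField.adjoin k {x}
  let x' : K := ⟨x, H.self_mem⟩
  let : Algebra k[X] K := (aeval x').toAlgebra
  let : Algebra k[X] F := (aeval x).toAlgebra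
  have e : ∀ q : k[X], ((aeval x' q : K) : F) = aeval x q := fun q =>
    (aeval_algebraMap_apply F x' q).symm
  have : IsScalarTower k k[X] F := IsScalarTower.of_algebraMap_eq fun c => (aeval_C x c).symm
  have : IsScalarTower k[X] K F := IsScalarTower.of_algebraMap_eq fun q => (e q).symm
  have hinj : Function.Injective (algebraMap k[X] K) := by
    rw [injective_iff_map_eq_zero]
    intro q hq
    by_contra h0
    refine H.aeval_ne_zero h0 ?_
    rw [← e]
    exact congrArg Subtype.val hq
  have : FaithfulSMul k[X] K := (faithfulSMul_iff_algebraMap_injective _ _).2 hinj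
  have : IsFractionRing k[X] K := IsFractionRing.of_field _ _ fun z => by
    obtain ⟨n, d, hz⟩ := IntermediateField.mem_adjoin_simple_iff k z.1 |>.1 z.2
    exact ⟨n, d, Subtype.ext (hz.trans (by rw [← e, ← e]; rfl))⟩
  -- k(x) is a localization of k[X] and F is separable over k(x), so F is formally étale over k[X]
  -- and Ω of F is the base change of the free module on dX.
  have : Algebra.FormallyEtale k[X] K := Algebra.FormallyEtale.of_isLocalization (nonZeroDivisors k[X])
  have : Algebra.FormallyEtale K F := Algebra.FormallyEtale.of_isSeparable K F
  have : Algebra.FormallyEtale k[X] F := Algebra.FormallyEtale.comp k[X] K F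
  refine ⟨(KaehlerDifferential.tensorKaehlerEquivOfFormallyEtale k k[X] F).symm.trans
    ((TensorProduct.AlgebraTensorModule.congr (LinearEquiv.refl F F)
      (KaehlerDifferential.polynomialEquiv k)).trans
      (TensorProduct.AlgebraTensorModule.rid k[X] F F)), ?_⟩
  have h1 := KaehlerDifferential.tensorKaehlerEquivOfFormallyEtale_symm_D_algebraMap k k[X] F X
  have hx : algebraMap k[X] F X = x := aeval_X x
  rw [hx] at h1
  simp [h1]

theorem D_ne_zero [CharP k p] (H : IsCover p ρ l f x y) : KaehlerDifferential.D k F x ≠ 0 := by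
  obtain ⟨e, he⟩ := H.exists_equiv
  intro h
  simp [h] at he

theorem exists_eq_smul_D [CharP k p] (H : IsCover p ρ l f x y) (ω : Ω[F⁄k]) :
    ∃ h : F, ω = h • KaehlerDifferential.D k F x := by
  obtain ⟨e, he⟩ := H.exists_equiv
  exact ⟨e ω, e.injective (by simp [he])⟩

end IsCover

end ArtinSchreier

/-! ### Regular differentials at unramified points -/

namespace CurvePoint

variable {k F : Type*} [Field k] [Field F] [Algebra k F]

/-- The functions regular at `P` whose differential is a regular multiple of `du`. -/
def regularDeriv (P : CurvePoint k F) (u : F) : Subalgebra k F where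
  carrier := {g | g ∈ P.localRing ∧
    ∃ g' ∈ P.localRing, KaehlerDifferential.D k F g = g' • KaehlerDifferential.D k F u}
  mul_mem' := by
    rintro a b ⟨ha, a', ha', ea⟩ ⟨hb, b', hb', eb⟩
    refine ⟨mul_mem ha hb, a * b' + b * a', add_mem (mul_mem ha hb') (mul_mem hb ha'), ?_⟩
    rw [Derivation.leibniz, ea, eb, smul_smul, smul_smul, add_smul]
  add_mem' := by
    rintro a b ⟨ha, a', ha', ea⟩ ⟨hb, b', hb', eb⟩
    exact ⟨add_mem ha hb, a' + b', add_mem ha' hb', by rw [map_add, ea, eb, add_smul]⟩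
  algebraMap_mem' c := ⟨P.algebraMap_mem c, 0, zero_mem _, by simp⟩

variable {P : CurvePoint k F} {u : F}

theorem inv_mem_regularDeriv {g : F} (hg : g ∈ P.regularDeriv u) (h : P.val g = 1) :
    g⁻¹ ∈ P.regularDeriv u := by
  obtain ⟨hg, g', hg', e⟩ := hg
  have hi : g⁻¹ ∈ P.localRing := P.val_le_one_iff.1 (by rw [map_inv₀, h, inv_one])
  refine ⟨hi, -(g⁻¹ ^ 2) * g', mul_mem (neg_mem (pow_mem hi 2)) hg', ?_⟩
  rw [Derivation.leibniz_inv, e, smul_smul]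

theorem self_mem_regularDeriv (hu : P.val u ≤ 1) : u ∈ P.regularDeriv u :=
  ⟨P.val_le_one_iff.1 hu, 1, one_mem _, (one_smul _ _).symm⟩

theorem aeval_mem_regularDeriv (hu : P.val u ≤ 1) (q : k[X]) : aeval u q ∈ P.regularDeriv u := by
  rw [aeval_eq_sum_range]
  exact sum_mem fun i _ => Subalgebra.smul_mem _ (pow_mem (self_mem_regularDeriv hu) i) _

/-- In characteristic p, d(y^p - y) = -dy. -/
theorem mem_regularDeriv_of_pow_sub {p : ℕ} [CharP k p] {y : F} (hy : y ∈ P.localRing)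
    (h : y ^ p - y ∈ P.regularDeriv u) : y ∈ P.regularDeriv u := by
  have : CharP F p := (Algebra.charP_iff k F p).1 inferInstance
  obtain ⟨-, g', hg', e⟩ := h
  refine ⟨hy, -g', neg_mem hg', ?_⟩
  rw [map_sub, Derivation.leibniz_pow] at e
  rw [neg_smul, ← e, ← Nat.cast_smul_eq_nsmul F, CharP.cast_eq_zero]
  simp

/-- The fractions in `k(u)` which are regular at `u = 0`. -/
def regularFractions (k : Type*) {F : Type*} [Field k] [Field F] [Algebra k F] (u : F) : Set F :=
  {a | ∃ n d : k[X], d.eval 0 ≠ 0 ∧ a = aeval u n / aeval u d}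

theorem regularFractions_subset (hu : P.val u < 1) :
    regularFractions k u ⊆ P.regularDeriv u := by
  rintro _ ⟨n, d, hd, rfl⟩
  rw [div_eq_mul_inv]
  exact mul_mem (aeval_mem_regularDeriv hu.le n) (inv_mem_regularDeriv
    (aeval_mem_regularDeriv hu.le d) (P.val_aeval_eq_one (c := 0) (by simpa using hu) hd))

theorem exists_eq_add_mul_of_mem_regularFractions (hu : Transcendental k u) {a : F}
    (ha : a ∈ regularFractions k u) :
    ∃ (c : k) (w : F), w ∈ regularFractions k u ∧ a = algebraMap k F c + u * w := by
  obtain ⟨n, d, hd, rfl⟩ := ha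
  have hd0 : aeval u d ≠ 0 := fun h => hu ⟨d, by rintro rfl; simp at hd, h⟩
  obtain ⟨w, hw⟩ : X ∣ n - C (n.eval 0 / d.eval 0) * d := by
    rw [X_dvd_iff, coeff_zero_eq_eval_zero]
    simp [hd]
  refine ⟨n.eval 0 / d.eval 0, _, ⟨w, d, hd, rfl⟩, ?_⟩
  have e := congrArg (aeval u) hw
  simp only [map_sub, map_mul, aeval_C, aeval_X] at e
  field_simp
  linear_combination e

theorem exists_pow_mul_mem_regularFractions {a : F}
    (ha : a ∈ IntermediateField.adjoin k {u}) : ∃ N : ℕ, u ^ N * a ∈ regularFractions k u := by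
  obtain ⟨n, d, rfl⟩ := IntermediateField.mem_adjoin_simple_iff k a |>.1 ha
  by_cases hd : aeval u d = 0
  · exact ⟨0, 0, 1, by simp, by simp [hd]⟩
  have hd0 : d ≠ 0 := by rintro rfl; simp at hd
  obtain ⟨w, hw, hw'⟩ := exists_eq_pow_rootMultiplicity_mul_and_not_dvd d hd0 0
  refine ⟨d.rootMultiplicity 0, n, w, by rwa [dvd_iff_isRoot] at hw', ?_⟩
  have e := congrArg (aeval u) hw
  rw [map_zero, sub_zero, map_mul, map_pow, aeval_X] at e
  rw [e, ← ne_eq, mul_ne_zero_iff] at hd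
  rw [e]
  have := hd.1
  have := hd.2
  field_simp

/-- At a point over `u = 0` where the equation `y ^ p - y = R(u)` is étale, the differential of a
regular function is a regular multiple of `du`. -/
theorem exists_D_eq_smul [IsAlgClosed k] {p : ℕ} [CharP k p] (hp : p.Prime)
    (hu : Transcendental k u) (hval : P.val u < 1) {y : F}
    (hy : y ^ p - y ∈ regularFractions k u)
    (hF : ∀ h : F, ∃ a : ℕ → F, (∀ μ, a μ ∈ IntermediateField.adjoin k {u}) ∧
      h = ∑ μ ∈ Finset.range p, a μ * y ^ μ) (hyP : P.val y ≤ 1)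
    {g : F} (hg : g ∈ P.localRing) : g ∈ P.regularDeriv u := by
  have := Fact.mk hp
  have : CharP F p := (Algebra.charP_iff k F p).1 inferInstance
  have hu0 : u ≠ 0 := by rintro rfl; exact hu isAlgebraic_zero
  have hAB := regularFractions_subset (k := k) hval
  -- For elements of `S` the claim is clear. The rest of the proof shows that every function regular
  -- at P is an element of `S` divided by a power of a unit `s` in `S`.
  let S : Subalgebra k F := Algebra.adjoin k (regularFractions k u ∪ {y})
  have hAS : regularFractions k u ⊆ S := fun a ha => Algebra.subset_adjoin (Or.inl ha)
  have hyS : y ∈ S := Algebra.subset_adjoin (Or.inr rfl)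
  have huS : u ∈ S := hAS ⟨X, 1, by simp, by simp⟩
  have hSB : S ≤ P.regularDeriv u := Algebra.adjoin_le (Set.union_subset hAB
    (by simpa using mem_regularDeriv_of_pow_sub (P.val_le_one_iff.1 hyP) (hAB hy)))
  obtain ⟨c₀, w, hw, hc₀⟩ := exists_eq_add_mul_of_mem_regularFractions hu hy
  have hwO : P.val w ≤ 1 := P.val_le_one_iff.2 (hAB hw).1
  have huw : P.val (u * w) < 1 := by
    rw [map_mul]
    exact mul_lt_one_of_lt_of_le hval hwO
  obtain ⟨β, hβ⟩ : ∃ β : k, P.val (y - algebraMap k F β) < 1 := by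
    refine P.exists_val_sub_lt hyP (q := X ^ p - X - C c₀) ?_ ?_
    · have : (X ^ p - X - C c₀ : k[X]).Monic := by
        rw [sub_sub]
        refine monic_X_pow_sub ?_
        rw [degree_X_add_C]
        exact_mod_cast hp.one_lt
      exact this.ne_zero
    · simpa [hc₀] using huw
  -- The difference of the two sides is a constant lying in the maximal ideal at P, hence zero.
  have hβ' : algebraMap k F β ^ p - algebraMap k F β = algebraMap k F c₀ := by
    by_contra hne
    have h1 : P.val (algebraMap k F (β ^ p - β - c₀)) = 1 := P.val_algebraMap fun h => hne (by
      rw [← map_pow, ← map_sub, sub_eq_zero.1 h])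
    have h2 : algebraMap k F (β ^ p - β - c₀) =
        u * w - ((y - algebraMap k F β) ^ p - (y - algebraMap k F β)) := by
      rw [sub_pow_char, map_sub, map_sub, map_pow]
      linear_combination hc₀
    have h3 : P.val ((y - algebraMap k F β) ^ p) < 1 := by
      rw [map_pow]
      exact pow_lt_one₀ zero_le hβ hp.ne_zero
    have h4 := P.val.map_sub_lt huw (P.val.map_sub_lt h3 hβ)
    rw [← h2, h1] at h4
    exact lt_irrefl _ h4
  -- From (y - β)^p - (y - β) = u w comes (y - β) s = u w, and s is a unit at P. So, up to the unit
  -- s, y - β is a multiple of u inside `S`.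
  let s : F := (y - algebraMap k F β) ^ (p - 1) - 1
  have hyβS : y - algebraMap k F β ∈ S := sub_mem hyS (S.algebraMap_mem β)
  have hsS : s ∈ S := sub_mem (pow_mem hyβS _) (one_mem S)
  have hs1 : P.val s = 1 := by
    have := hp.two_le
    rw [P.val.map_sub_eq_of_lt_right, map_one]
    rw [map_one, map_pow]
    exact pow_lt_one₀ zero_le hβ (by omega)
  have hsu : (y - algebraMap k F β) * s = u * w := by
    have h1 : (y - algebraMap k F β) * s =
        (y - algebraMap k F β) ^ p - (y - algebraMap k F β) := by
      rw [mul_sub, mul_one, mul_pow_sub_one hp.ne_zero]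
    rw [h1, sub_pow_char]
    linear_combination hc₀ - hβ'
  have hdec : ∀ h ∈ S, ∃ (c : k), ∃ h₁ ∈ S, ∃ h₂ ∈ S,
      h = algebraMap k F c + (y - algebraMap k F β) * h₁ + u * h₂ := by
    intro h hh
    induction hh using Algebra.adjoin_induction with
    | mem a ha =>
      rcases ha with ha | rfl
      · obtain ⟨c, b, hb, e⟩ := exists_eq_add_mul_of_mem_regularFractions hu ha
        exact ⟨c, 0, zero_mem S, b, hAS hb, by rw [e]; ring⟩
      · exact ⟨β, 1, one_mem S, 0, zero_mem S, by ring⟩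
    | algebraMap c => exact ⟨c, 0, zero_mem S, 0, zero_mem S, by ring⟩
    | add a b _ _ iha ihb =>
      obtain ⟨c, a₁, ha₁, a₂, ha₂, ea⟩ := iha
      obtain ⟨d, b₁, hb₁, b₂, hb₂, eb⟩ := ihb
      exact ⟨c + d, a₁ + b₁, add_mem ha₁ hb₁, a₂ + b₂, add_mem ha₂ hb₂, by
        rw [ea, eb, map_add]; ring⟩
    | mul a b _ hb iha ihb =>
      obtain ⟨c, a₁, ha₁, a₂, ha₂, ea⟩ := iha
      obtain ⟨d, b₁, hb₁, b₂, hb₂, eb⟩ := ihb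
      refine ⟨c * d, algebraMap k F c * b₁ + a₁ * b,
        add_mem (mul_mem (S.algebraMap_mem c) hb₁) (mul_mem ha₁ hb),
        algebraMap k F c * b₂ + a₂ * b,
        add_mem (mul_mem (S.algebraMap_mem c) hb₂) (mul_mem ha₂ hb), ?_⟩
      rw [map_mul]
      linear_combination b * ea + algebraMap k F c * eb
  -- An element of `S` vanishing at P has zero constant term c in `hdec`; multiplying by s turns its
  -- (y - β)-part into a multiple of u.
  have hstep : ∀ h ∈ S, P.val h < 1 → ∃ h' ∈ S, s * h = u * h' := by
    intro h hh hlt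
    obtain ⟨c, h₁, hh₁, h₂, hh₂, e⟩ := hdec h hh
    have hc : c = 0 := by
      by_contra hc
      have h1 : algebraMap k F c = h - ((y - algebraMap k F β) * h₁ + u * h₂) := by rw [e]; ring
      have h2 : ∀ z ∈ S, ∀ t, P.val t < 1 → P.val (t * z) < 1 := fun z hz t ht => by
        rw [map_mul]
        exact mul_lt_one_of_lt_of_le ht (P.val_le_one_iff.2 (hSB hz).1)
      have h3 := P.val.map_sub_lt hlt (P.val.map_add_lt (h2 h₁ hh₁ _ hβ) (h2 h₂ hh₂ _ hval))
      rw [← h1, P.val_algebraMap hc] at h3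
      exact lt_irrefl _ h3
    refine ⟨w * h₁ + s * h₂, add_mem (mul_mem (hAS hw) hh₁) (mul_mem hsS hh₂), ?_⟩
    rw [e, hc, map_zero]
    linear_combination h₁ * hsu
  have hdesc : ∀ N : ℕ, ∀ h ∈ S, P.val h ≤ P.val u ^ N → ∃ h' ∈ S, s ^ N * h = u ^ N * h' := by
    intro N
    induction N with
    | zero => exact fun h hh _ => ⟨h, hh, by simp⟩
    | succ N ih =>
      intro h hh hle
      obtain ⟨h', hh', e⟩ := hstep h hh (hle.trans_lt (pow_lt_one₀ zero_le hval (by omega)))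
      have hle' : P.val h' ≤ P.val u ^ N := by
        have h1 := congrArg P.val e
        rw [map_mul, map_mul, hs1, one_mul] at h1
        rw [h1, pow_succ'] at hle
        exact le_of_mul_le_mul_left hle (zero_lt_iff.2 ((P.val.ne_zero_iff).2 hu0))
      obtain ⟨h'', hh'', e'⟩ := ih h' hh' hle'
      refine ⟨h'', hh'', ?_⟩
      rw [pow_succ, pow_succ]
      linear_combination s ^ N * e + u * e'
  -- Clearing the poles at u = 0 of the coefficients of `g` brings it into `S`; `hdesc` then removes
  -- the factor u^N at the cost of s^N.
  obtain ⟨N, hN⟩ : ∃ N : ℕ, u ^ N * g ∈ S := by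
    obtain ⟨a, ha, rfl⟩ := hF g
    choose N hN using fun μ => exists_pow_mul_mem_regularFractions (ha μ)
    refine ⟨∑ μ ∈ Finset.range p, N μ, ?_⟩
    rw [Finset.mul_sum]
    refine sum_mem fun μ hμ => ?_
    rw [← Finset.sum_erase_add _ _ hμ, pow_add]
    have : u ^ (∑ μ ∈ (Finset.range p).erase μ, N μ) * u ^ N μ * (a μ * y ^ μ) =
        u ^ (∑ μ ∈ (Finset.range p).erase μ, N μ) * (u ^ N μ * a μ) * y ^ μ := by ring
    rw [this]
    exact mul_mem (mul_mem (pow_mem huS _) (hAS (hN μ))) (pow_mem hyS μ)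
  obtain ⟨h', hh', e⟩ := hdesc N _ hN (by
    rw [map_mul, map_pow]
    exact mul_le_of_le_one_right' (P.val_le_one_iff.2 hg))
  have hs0 : s ≠ 0 := by
    intro h
    simp [h] at hs1
  have : g = h' * (s ^ N)⁻¹ := by
    have : u ^ N ≠ 0 := pow_ne_zero _ hu0
    field_simp
    refine mul_left_cancel₀ this ?_
    linear_combination e
  rw [this]
  exact mul_mem (hSB hh') (inv_mem_regularDeriv (hSB (pow_mem hsS N)) (by simp [hs1]))

end CurvePoint

/-! ### Stalks of differentials as multiples of one differential -/

namespace CurvePoint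

variable {k F : Type*} [Field k] [Field F] [Algebra k F] (P : CurvePoint k F)

theorem smul_D_mem_differentials {g u : F} (hg : g ∈ P.localRing) (hu : u ∈ P.localRing) :
    g • KaehlerDifferential.D k F u ∈ P.differentials :=
  P.differentials.smul_mem (⟨g, hg⟩ : P.localRing.toSubring) (Submodule.subset_span ⟨u, hu, rfl⟩)

/-- The set `S` bounds the coefficients: it is the local ring at unramified points, and a larger
module over it at ramified points, where dx vanishes. -/
theorem exists_eq_smul_of_mem_differentials {u : F} (S : AddSubmonoid F)
    (hS : ∀ c ∈ P.localRing, ∀ s ∈ S, c * s ∈ S)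
    (h : ∀ g ∈ P.localRing, ∃ g' ∈ S,
      KaehlerDifferential.D k F g = g' • KaehlerDifferential.D k F u)
    {ω : Ω[F⁄k]} (hω : ω ∈ P.differentials) :
    ∃ g ∈ S, ω = g • KaehlerDifferential.D k F u := by
  induction hω using Submodule.span_induction with
  | mem ω hω =>
    obtain ⟨g, hg, rfl⟩ := hω
    exact h g hg
  | zero => exact ⟨0, zero_mem _, (zero_smul _ _).symm⟩
  | add a b _ _ iha ihb =>
    obtain ⟨a', ha', rfl⟩ := iha
    obtain ⟨b', hb', rfl⟩ := ihb
    exact ⟨a' + b', add_mem ha' hb', (add_smul _ _ _).symm⟩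
  | smul c a _ iha =>
    obtain ⟨a', ha', rfl⟩ := iha
    refine ⟨c * a', hS c c.2 a' ha', ?_⟩
    rw [mul_smul]
    exact (algebraMap_smul F c _).symm

theorem val_lt_one_iff_inv_notMem {z : F} (hz : z ≠ 0) : P.val z < 1 ↔ z⁻¹ ∉ P.localRing := by
  have := P.localRing.mem_nonunits_iff_or (x := z)
  rw [ValuationSubring.mem_nonunits_iff] at this
  simpa [hz] using this

theorem D_aeval (x : F) (q : k[X]) : KaehlerDifferential.D k F (aeval x q) =
    aeval x (derivative q) • KaehlerDifferential.D k F x :=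
  Derivation.map_aeval _ _ _

theorem D_div_aeval {x : F} {d : k[X]} (hd : aeval x d ≠ 0) (n : k[X]) :
    KaehlerDifferential.D k F (aeval x n / aeval x d) =
      ((aeval x (derivative n) * aeval x d - aeval x n * aeval x (derivative d))
        / aeval x d ^ 2) • KaehlerDifferential.D k F x := by
  rw [Derivation.leibniz_div, D_aeval, D_aeval, smul_smul, smul_smul, ← sub_smul, smul_smul]
  congr 1
  field_simp

end CurvePoint

/-! ### The differential of y and the unramified points -/

namespace ArtinSchreier

variable {k F : Type*} [Field k] [Field F] [Algebra k F] {r : ℕ}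

/-- This is the logarithmic derivative of the product with denominators cleared. -/
theorem derivative_prod_mul (ρ : Fin r → k) (l : Fin r → ℕ) :
    derivative (∏ i, (X - C (ρ i)) ^ l i) * ∏ i, (X - C (ρ i)) =
      (∏ i, (X - C (ρ i)) ^ l i) *
        ∑ i, C (l i : k) * ∏ j ∈ Finset.univ.erase i, (X - C (ρ j)) := by
  rw [derivative_prod_finset, Finset.sum_mul, Finset.mul_sum]
  refine Finset.sum_congr rfl fun i _ => ?_
  rw [← Finset.mul_prod_erase _ (fun i => (X - C (ρ i)) ^ l i) (Finset.mem_univ i),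
    ← Finset.mul_prod_erase _ (fun i => X - C (ρ i)) (Finset.mem_univ i), derivative_X_sub_C_pow]
  rcases Nat.eq_zero_or_pos (l i) with h | h
  · simp [h]
  · obtain ⟨n, hn⟩ := Nat.exists_eq_add_of_le' h
    simp only [hn, Nat.add_sub_cancel, map_natCast]
    ring

namespace IsCover

variable {p : ℕ} {ρ : Fin r → k} {l : Fin r → ℕ} {f : k[X]} {x y : F}

/-- Since dy = -d(y^p - y), this is the quotient rule for the right-hand side of the equation; it
explains the shape of ψ. -/
theorem D_y [CharP k p] (H : IsCover p ρ l f x y) : KaehlerDifferential.D k F y =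
    (aeval x (psi ρ l f) / aeval x (∏ i, (X - C (ρ i)) ^ (l i + 1))) •
      KaehlerDifferential.D k F x := by
  have : CharP F p := (Algebra.charP_iff k F p).1 inferInstance
  have hd := H.aeval_ne_zero (prod_monic ρ l).ne_zero
  have hd1 : aeval x (∏ i, (X - C (ρ i))) ≠ 0 :=
    H.aeval_ne_zero (by simpa using (prod_monic ρ 1).ne_zero)
  have h1 : KaehlerDifferential.D k F y = -KaehlerDifferential.D k F (y ^ p - y) := by
    rw [map_sub, Derivation.leibniz_pow, ← Nat.cast_smul_eq_nsmul F, CharP.cast_eq_zero]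
    simp
  rw [h1, H.equation, CurvePoint.D_div_aeval hd, ← neg_smul]
  congr 1
  have e1 := congrArg (aeval x) (derivative_prod_mul ρ l)
  have e2 : ∏ i, (X - C (ρ i)) ^ (l i + 1) =
      (∏ i, (X - C (ρ i)) ^ l i) * ∏ i, (X - C (ρ i)) := by
    rw [← Finset.prod_mul_distrib]
    simp_rw [pow_succ]
  rw [e2, psi, map_sub, map_mul, map_mul, map_mul]
  rw [map_mul, map_mul] at e1
  field_simp
  linear_combination aeval x f * e1

/-- At ρ_i only f(ρ_i) l_i ∏ (ρ_i - ρ_j) survives, and l_i is nonzero in k. So dy/dx has a pole of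
exact order l_i + 1 in x - ρ_i. -/
theorem eval_psi_ne_zero [CharP k p] (H : IsCover p ρ l f x y) (i : Fin r) :
    (psi ρ l f).eval (ρ i) ≠ 0 := by
  have hl : (l i : k) ≠ 0 := by
    rw [Ne, CharP.cast_eq_zero_iff k p]
    intro h
    have := (H.coprime i).symm.eq_one_of_dvd h
    exact H.prime.one_lt.ne' this
  have h1 : eval (ρ i) (∏ i, (X - C (ρ i))) = 0 := by
    rw [eval_prod]
    exact Finset.prod_eq_zero (Finset.mem_univ i) (by simp)
  have h2 : eval (ρ i) (∑ i, C (l i : k) * ∏ j ∈ Finset.univ.erase i, (X - C (ρ j))) =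
      l i * ∏ j ∈ Finset.univ.erase i, (ρ i - ρ j) := by
    rw [eval_finsetSum, Finset.sum_eq_single i]
    · simp [eval_prod]
    · intro j _ hj
      rw [eval_mul, eval_prod, Finset.prod_eq_zero (i := i)]
      · simp
      · simpa using hj.symm
      · simp
    · simp
  rw [psi, eval_sub, eval_mul, eval_mul, h1, h2, mul_zero, sub_zero]
  refine mul_ne_zero (H.eval_f_ne_zero i) (mul_ne_zero hl (Finset.prod_ne_zero_iff.2 ?_))
  intro j hj
  exact _root_.sub_ne_zero.2 fun h => absurd (H.injective h).symm (Finset.ne_of_mem_erase hj)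

/-! #### Unramified points -/

theorem adjoin_sub (_ : IsCover p ρ l f x y) (c : k) :
    IntermediateField.adjoin k {x - algebraMap k F c} = IntermediateField.adjoin k {x} := by
  refine le_antisymm (IntermediateField.adjoin_simple_le_iff.2 ?_)
    (IntermediateField.adjoin_simple_le_iff.2 ?_)
  · exact sub_mem (IntermediateField.mem_adjoin_simple_self k x) (algebraMap_mem _ c)
  · have := add_mem (IntermediateField.mem_adjoin_simple_self k (x - algebraMap k F c))
      (algebraMap_mem _ c)
    rwa [sub_add_cancel] at this

theorem adjoin_inv (_ : IsCover p ρ l f x y) :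
    IntermediateField.adjoin k {x⁻¹} = IntermediateField.adjoin k {x} := by
  refine le_antisymm (IntermediateField.adjoin_simple_le_iff.2 ?_)
    (IntermediateField.adjoin_simple_le_iff.2 ?_)
  · exact inv_mem (IntermediateField.mem_adjoin_simple_self k x)
  · simpa using inv_mem (IntermediateField.mem_adjoin_simple_self k x⁻¹)

theorem exists_D_eq_smul_of_ne [IsAlgClosed k] [CharP k p] (H : IsCover p ρ l f x y)
    (P : CurvePoint k F) {c : k}
    (h : P.val (x - algebraMap k F c) < 1) (hc : ∀ i, ρ i ≠ c) {g : F} (hg : g ∈ P.localRing) :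
    ∃ g' ∈ P.localRing, KaehlerDifferential.D k F g = g' • KaehlerDifferential.D k F x := by
  have key := CurvePoint.exists_D_eq_smul H.prime (H.transcendental_sub c) h (y := y) ?_ ?_
    (H.y_mem_of_mem P (H.equation_mem_of_ne P h hc)) hg
  · obtain ⟨-, g', hg', e⟩ := key
    exact ⟨g', hg', by simpa using e⟩
  · refine ⟨f.comp (X + C c), (∏ i, (X - C (ρ i)) ^ l i).comp (X + C c), ?_, ?_⟩
    · simp only [eval_comp, eval_add, eval_X, eval_C, zero_add]
      rw [eval_prod, Finset.prod_ne_zero_iff]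
      intro j hj
      simpa [sub_eq_zero] using fun h0 => absurd h0.symm (hc j)
    · rw [H.equation, aeval_comp, aeval_comp]
      simp
  · rw [H.adjoin_sub]
    exact H.exists_sum

theorem mem_differentials_of_ne [IsAlgClosed k] [CharP k p] (H : IsCover p ρ l f x y)
    (P : CurvePoint k F) {c : k}
    (h : P.val (x - algebraMap k F c) < 1) (hc : ∀ i, ρ i ≠ c) {g : F} :
    g • KaehlerDifferential.D k F x ∈ P.differentials ↔ P.val g ≤ 1 := by
  rw [P.val_le_one_iff]
  refine ⟨fun hg => ?_, fun hg => P.smul_D_mem_differentials hg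
    (P.val_le_one_iff.1 (P.val_le_one_of_val_sub_lt h))⟩
  obtain ⟨g', hg', e⟩ := P.exists_eq_smul_of_mem_differentials
    P.localRing.toSubring.toAddSubgroup.toAddSubmonoid (fun _ hc _ hs => P.localRing.mul_mem _ _ hc hs)
    (fun _ => H.exists_D_eq_smul_of_ne P h hc) hg
  rwa [smul_left_injective F H.D_ne_zero e]

theorem D_inv_eq (_ : IsCover p ρ l f x y) : KaehlerDifferential.D k F x⁻¹ =
    (-(x⁻¹ ^ 2)) • KaehlerDifferential.D k F x := by
  rw [Derivation.leibniz_inv]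

theorem exists_D_eq_smul_of_infty [IsAlgClosed k] [CharP k p] (H : IsCover p ρ l f x y)
    (P : CurvePoint k F)
    (h : 1 < P.val x) {g : F} (hg : g ∈ P.localRing) :
    ∃ g' ∈ P.localRing, KaehlerDifferential.D k F g = g' • KaehlerDifferential.D k F x⁻¹ := by
  have h0 : 0 < P.val x := zero_lt_one.trans h
  refine (CurvePoint.exists_D_eq_smul H.prime H.transcendental_inv (y := y)
    (by rw [map_inv₀]; exact (inv_lt_one₀ h0).2 h) ?_ ?_
    (H.y_mem_of_mem P (H.equation_mem_of_infty P h)) hg).2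
  -- In the coordinate 1/x both polynomials are reversed. The powers of x cancel because numerator
  -- and denominator have the same degree.
  · refine ⟨f.reverse, (∏ i, (X - C (ρ i)) ^ l i).reverse, ?_, ?_⟩
    · rw [← coeff_zero_eq_eval_zero, coeff_zero_reverse, (prod_monic ρ l).leadingCoeff]
      exact one_ne_zero
    · let := invertibleOfNonzero H.ne_zero
      have e : ∀ q : k[X], aeval x⁻¹ q.reverse * x ^ q.natDegree = aeval x q := fun q => by
        have e := eval₂_reverse_mul_pow (algebraMap k F) x q
        rwa [← aeval_def, ← aeval_def, invOf_eq_inv] at e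
      rw [H.equation, ← e f, ← e (∏ i, (X - C (ρ i)) ^ l i), natDegree_prod_sub_pow,
        H.natDegree_eq, mul_div_mul_right]
      exact pow_ne_zero _ H.ne_zero
  · rw [H.adjoin_inv]
    exact H.exists_sum

/-- Here 1/x is the coordinate and dx = -x² d(1/x), whence the factor x². -/
theorem mem_differentials_of_infty [IsAlgClosed k] [CharP k p] (H : IsCover p ρ l f x y)
    (P : CurvePoint k F)
    (h : 1 < P.val x) {g : F} :
    g • KaehlerDifferential.D k F x ∈ P.differentials ↔ P.val (g * x ^ 2) ≤ 1 := by
  have hx := H.ne_zero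
  have h0 : 0 < P.val x := zero_lt_one.trans h
  rw [P.val_le_one_iff]
  constructor
  · intro hg
    obtain ⟨g', hg', e⟩ := P.exists_eq_smul_of_mem_differentials
      P.localRing.toSubring.toAddSubgroup.toAddSubmonoid (fun _ hc _ hs => P.localRing.mul_mem _ _ hc hs)
      (fun _ => H.exists_D_eq_smul_of_infty P h) hg
    rw [H.D_inv_eq, smul_smul] at e
    rw [smul_left_injective F H.D_ne_zero e]
    have : g' * -x⁻¹ ^ 2 * x ^ 2 = -g' := by field_simp
    rw [this]
    exact neg_mem hg'
  · intro hg
    have e : g • KaehlerDifferential.D k F x =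
        (-(g * x ^ 2)) • KaehlerDifferential.D k F x⁻¹ := by
      rw [H.D_inv_eq, smul_smul]
      congr 1
      field_simp
    rw [e]
    refine P.smul_D_mem_differentials (neg_mem hg) (P.val_le_one_iff.1 ?_)
    rw [map_inv₀]
    exact ((inv_lt_one₀ h0).2 h).le

theorem val_coeff_le_of_ne [CharP k p] (H : IsCover p ρ l f x y)
    (P : CurvePoint k F) {c : k}
    (h : P.val (x - algebraMap k F c) < 1) (hc : ∀ i, ρ i ≠ c) {a : ℕ → F}
    (ha : ∀ μ, a μ ∈ IntermediateField.adjoin k {x})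
    (hreg : ∀ P' : CurvePoint k F, P'.val (x - algebraMap k F c) < 1 →
      ∑ μ ∈ Finset.range p, a μ * y ^ μ ∈ P'.localRing) {μ : ℕ} (hμ : μ < p) :
    P.val (a μ) ≤ 1 := by
  refine H.val_coeff_le P (H.y_mem_of_mem P (H.equation_mem_of_ne P h hc)) ha
    (fun P' hP' => hreg P' ?_) hμ
  -- Vanishing of x - c is rephrased as non-regularity of an element of k(x), which transfers
  -- between points of one fibre.
  rw [CurvePoint.val_lt_one_iff_inv_notMem _ (H.sub_ne_zero c)] at h ⊢
  rwa [hP']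
  exact inv_mem (sub_mem H.self_mem (algebraMap_mem _ c))

theorem val_coeff_le_of_infty [CharP k p] (H : IsCover p ρ l f x y)
    (P : CurvePoint k F)
    (h : 1 < P.val x) {a : ℕ → F} (ha : ∀ μ, a μ ∈ IntermediateField.adjoin k {x})
    (hreg : ∀ P' : CurvePoint k F, 1 < P'.val x →
      ∑ μ ∈ Finset.range p, a μ * y ^ μ ∈ P'.localRing) {μ : ℕ} (hμ : μ < p) :
    P.val (a μ) ≤ 1 := by
  refine H.val_coeff_le P (H.y_mem_of_mem P (H.equation_mem_of_infty P h)) ha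
    (fun P' hP' => hreg P' ?_) hμ
  rw [← not_le, CurvePoint.val_le_one_iff] at h ⊢
  rwa [hP' _ H.self_mem]

end IsCover

end ArtinSchreier

/-! ### Orders of derivatives -/

namespace CurvePoint

variable {k F : Type*} [Field k] [Field F] [Algebra k F] (P : CurvePoint k F)

/-- The functions `z` with `v(z) ^ p * C ≤ 1`. -/
noncomputable def valPowLe (p : ℕ) (C : P.localRing.ValueGroup) (hp : p ≠ 0) : AddSubmonoid F where
  carrier := {z | P.val z ^ p * C ≤ 1}
  zero_mem' := by simp [hp]
  add_mem' := by
    intro a b ha hb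
    rcases le_max_iff.1 (P.val.map_add a b) with h | h
    · exact (mul_le_mul_left (pow_le_pow_left₀ zero_le h p) C).trans ha
    · exact (mul_le_mul_left (pow_le_pow_left₀ zero_le h p) C).trans hb

theorem mem_valPowLe {p : ℕ} {C : P.localRing.ValueGroup} {hp : p ≠ 0} {z : F} :
    z ∈ P.valPowLe p C hp ↔ P.val z ^ p * C ≤ 1 := Iff.rfl

theorem val_derivative_le {x : F} {c : k} (hx : x - algebraMap k F c ≠ 0)
    (h : P.val (x - algebraMap k F c) < 1) (q : k[X]) :
    P.val (aeval x (derivative q)) ≤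
      P.val (x - algebraMap k F c) ^ ((q.rootMultiplicity c : ℤ) - 1) := by
  have h0 := zero_lt_iff.2 ((P.val.ne_zero_iff).2 hx)
  obtain ⟨w, hw⟩ := pow_sub_one_dvd_derivative_of_pow_dvd (pow_rootMultiplicity_dvd q c)
  rw [hw, map_mul, map_mul]
  refine (mul_le_of_le_one_right' (P.val_aeval_le (P.val_le_one_of_val_sub_lt h) w)).trans ?_
  rw [map_pow, map_pow, map_sub, aeval_X, aeval_C, ← zpow_natCast,
    zpow_le_zpow_iff_right_of_lt_one₀ h0 h]
  omega

/-- Differentiation lowers the order at c by at most one; only an inequality holds, since the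
leading term may be killed in characteristic p. -/
theorem exists_D_eq_smul_of_mem_adjoin {x : F} (ht : Transcendental k x) {c : k}
    (h : P.val (x - algebraMap k F c) < 1) {a : F} (ha : a ∈ IntermediateField.adjoin k {x})
    {e : ℤ} (he : P.val a = P.val (x - algebraMap k F c) ^ e) :
    ∃ a' : F, KaehlerDifferential.D k F a = a' • KaehlerDifferential.D k F x ∧
      P.val a' ≤ P.val (x - algebraMap k F c) ^ (e - 1) := by
  have hx : x - algebraMap k F c ≠ 0 := by
    intro h
    rw [sub_eq_zero] at h
    exact ht (h ▸ isAlgebraic_algebraMap c)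
  have h0 := zero_lt_iff.2 ((P.val.ne_zero_iff).2 hx)
  obtain ⟨n, d, rfl⟩ := IntermediateField.mem_adjoin_simple_iff k a |>.1 ha
  have hne : aeval x n / aeval x d ≠ 0 := by
    rw [← P.val.ne_zero_iff, he]
    exact zpow_ne_zero _ h0.ne'
  have hn : n ≠ 0 := by rintro rfl; simp at hne
  have hd : d ≠ 0 := by rintro rfl; simp at hne
  rw [map_div₀, P.val_aeval_eq_pow h hn, P.val_aeval_eq_pow h hd, ← zpow_natCast, ← zpow_natCast,
    ← zpow_sub₀ h0.ne'] at he
  have he' := zpow_right_injective₀ h0 h.ne he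
  have hd' : aeval x d ≠ 0 := fun h => ht ⟨d, hd, h⟩
  refine ⟨_, D_div_aeval hd' n, ?_⟩
  have b1 : P.val (aeval x (derivative n) * aeval x d) ≤ P.val (x - algebraMap k F c) ^
      ((n.rootMultiplicity c : ℤ) + d.rootMultiplicity c - 1) := by
    rw [map_mul, P.val_aeval_eq_pow h hd, ← zpow_natCast]
    refine (mul_le_mul_left (P.val_derivative_le hx h n) _).trans (le_of_eq ?_)
    rw [← zpow_add₀ h0.ne']
    congr 1
    ring
  have b2 : P.val (aeval x n * aeval x (derivative d)) ≤ P.val (x - algebraMap k F c) ^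
      ((n.rootMultiplicity c : ℤ) + d.rootMultiplicity c - 1) := by
    rw [map_mul, P.val_aeval_eq_pow h hn, ← zpow_natCast]
    refine (mul_le_mul_right (P.val_derivative_le hx h d) _).trans (le_of_eq ?_)
    rw [← zpow_add₀ h0.ne']
    congr 1
    ring
  have b3 := P.val.map_sub_le b1 b2
  rw [map_div₀, map_pow, P.val_aeval_eq_pow h hd, ← pow_mul, ← zpow_natCast]
  refine (div_le_div₀ zero_le b3 (zpow_pos h0 _) le_rfl).trans (le_of_eq ?_)
  rw [← zpow_sub₀ h0.ne', ← he']
  congr 1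
  push_cast
  ring

end CurvePoint

namespace ArtinSchreier

variable {k F : Type*} [Field k] [Field F] [Algebra k F] {r : ℕ}

namespace IsCover

variable {p : ℕ} {ρ : Fin r → k} {l : Fin r → ℕ} {f : k[X]} {x y : F}

/-! #### Ramified points -/

theorem val_dy [CharP k p] (H : IsCover p ρ l f x y) (P : CurvePoint k F) {i : Fin r}
    (h : P.val (x - algebraMap k F (ρ i)) < 1) :
    P.val (aeval x (psi ρ l f) / aeval x (∏ i, (X - C (ρ i)) ^ (l i + 1))) =
      P.val (x - algebraMap k F (ρ i)) ^ (-(l i + 1 : ℤ)) := by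
  rw [map_div₀, P.val_aeval_eq_one h (H.eval_psi_ne_zero i),
    val_aeval_prod_of_eq P H.injective h (fun i => l i + 1), one_div, zpow_neg, ← zpow_natCast]
  push_cast
  rfl

theorem val_zpow_pow_le (H : IsCover p ρ l f x y) (P : CurvePoint k F) {i : Fin r}
    (h : P.val (x - algebraMap k F (ρ i)) < 1) {a : F} {e : ℤ}
    (ha : P.val a ≤ P.val (x - algebraMap k F (ρ i)) ^ e) (μ : ℕ) :
    P.val (a * y ^ μ) ^ p ≤ P.val (x - algebraMap k F (ρ i)) ^ (p * e - l i * μ : ℤ) := by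
  rw [← H.val_mul_pow_of_eq P h (a := (x - algebraMap k F (ρ i)) ^ e) (map_zpow₀ _ _ _)]
  rw [map_mul, map_mul]
  refine pow_le_pow_left₀ zero_le (mul_le_mul_left ?_ _) p
  rwa [map_zpow₀]

/-- Each term a_μ y^μ of a regular function is itself regular, so the bound can be checked term by
term on a'_μ y^μ + μ a_μ y^(μ-1) dy/dx. -/
theorem exists_D_eq_smul_of_eq [CharP k p] (H : IsCover p ρ l f x y) (P : CurvePoint k F)
    {i : Fin r} (h : P.val (x - algebraMap k F (ρ i)) < 1) {g : F} (hg : g ∈ P.localRing) :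
    ∃ g' ∈ P.valPowLe p (P.val (x - algebraMap k F (ρ i)) ^ ((p - 1) * (l i + 1)))
      H.prime.ne_zero, KaehlerDifferential.D k F g = g' • KaehlerDifferential.D k F x := by
  have h0 := zero_lt_iff.2 ((P.val.ne_zero_iff).2 (H.sub_ne_zero (ρ i)))
  have hp := H.three_le
  have hli := H.one_le i
  have hN : P.val (x - algebraMap k F (ρ i)) ^ ((p - 1) * (l i + 1)) =
      P.val (x - algebraMap k F (ρ i)) ^ (((p - 1) * (l i + 1) : ℤ)) := by
    rw [← zpow_natCast]
    push_cast [Nat.cast_sub (by omega : 1 ≤ p)]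
    rfl
  have hle : ∀ n : ℤ, 0 ≤ n → P.val (x - algebraMap k F (ρ i)) ^ n ≤ 1 := fun n hn => by
    rw [← zpow_zero (P.val (x - algebraMap k F (ρ i))), zpow_le_zpow_iff_right_of_lt_one₀ h0 h]
    exact hn
  obtain ⟨a, ha, rfl⟩ := H.exists_sum g
  have key : ∀ μ ∈ Finset.range p, ∃ g' ∈ P.valPowLe p
      (P.val (x - algebraMap k F (ρ i)) ^ ((p - 1) * (l i + 1))) H.prime.ne_zero,
      KaehlerDifferential.D k F (a μ * y ^ μ) = g' • KaehlerDifferential.D k F x := by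
    intro μ hμ
    rw [Finset.mem_range] at hμ
    by_cases haμ : a μ = 0
    · exact ⟨0, zero_mem _, by simp [haμ]⟩
    obtain ⟨e, he⟩ := P.exists_val_eq_zpow (H.sub_ne_zero _) h (ha μ) haμ
    obtain ⟨a', ea', ha'⟩ := P.exists_D_eq_smul_of_mem_adjoin H.transcendental h (ha μ) he
    have hv : 0 ≤ p * e - l i * μ := by
      have h1 := (H.val_le_val_sum P h ha hμ).trans (P.val_le_one_iff.2 hg)
      have h2 := pow_le_one₀ (n := p) zero_le h1
      rw [H.val_mul_pow_of_eq P h he, ← zpow_zero (P.val (x - algebraMap k F (ρ i))),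
        zpow_le_zpow_iff_right_of_lt_one₀ h0 h] at h2
      exact h2
    set η := aeval x (psi ρ l f) / aeval x (∏ i, (X - C (ρ i)) ^ (l i + 1)) with hη
    refine ⟨a' * y ^ μ + a μ * (μ * y ^ (μ - 1) * η), add_mem ?_ ?_, ?_⟩
    · rw [CurvePoint.mem_valPowLe, hN]
      refine (mul_le_mul_left (H.val_zpow_pow_le P h ha' μ) _).trans ?_
      rw [← zpow_add₀ h0.ne']
      refine hle _ ?_
      have : (2 : ℤ) * 1 ≤ (p - 1) * l i := mul_le_mul (by omega) (by omega) (by omega) (by omega)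
      linarith
    · rcases Nat.eq_zero_or_pos μ with rfl | hμ0
      · simp
      -- The pole of dy/dx leaves a deficit of one, absorbed because p does not divide l_i μ for 0 <
      -- μ < p, so the exponent is strictly positive.
      have hv' : 1 ≤ p * e - l i * μ := by
        rcases hv.lt_or_eq with h1 | h1
        · omega
        · exfalso
          refine H.not_dvd_mul i (n := μ) (by omega) (by rw [abs_lt]; omega) ⟨e, ?_⟩
          linarith
      have e1 : a μ * (μ * y ^ (μ - 1) * η) = μ * ((a μ * η) * y ^ (μ - 1)) := by ring
      have h1 : P.val (a μ * η) = P.val (x - algebraMap k F (ρ i)) ^ (e + -(l i + 1 : ℤ)) := by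
        rw [map_mul, hη, H.val_dy P h, he, zpow_add₀ h0.ne']
      rw [CurvePoint.mem_valPowLe, hN, e1, map_mul, mul_pow,
        H.val_mul_pow_of_eq P h h1, mul_assoc, ← zpow_add₀ h0.ne']
      refine mul_le_one' (pow_le_one₀ zero_le (P.val_natCast_le μ)) (hle _ ?_)
      push_cast [Nat.cast_sub hμ0]
      linarith
    · rw [Derivation.leibniz, Derivation.leibniz_pow, ea', H.D_y, ← Nat.cast_smul_eq_nsmul F,
        smul_smul, smul_smul, smul_smul, smul_smul, ← add_smul]
      congr 1
      ring
  choose! b hb eb using key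
  refine ⟨∑ μ ∈ Finset.range p, b μ, sum_mem hb, ?_⟩
  rw [map_sum, Finset.sum_smul]
  exact Finset.sum_congr rfl eb

/-- A local parameter at a ramified point, and the valuation of its derivative. -/
theorem exists_parameter [CharP k p] (H : IsCover p ρ l f x y) (P : CurvePoint k F) {i : Fin r}
    (h : P.val (x - algebraMap k F (ρ i)) < 1) :
    ∃ t t' : F, t ∈ P.localRing ∧
      KaehlerDifferential.D k F t = t' • KaehlerDifferential.D k F x ∧
      P.val t' ^ p * P.val (x - algebraMap k F (ρ i)) ^ ((p - 1) * (l i + 1)) = 1 := by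
  have h0 := zero_lt_iff.2 ((P.val.ne_zero_iff).2 (H.sub_ne_zero (ρ i)))
  have hp := H.three_le
  have hli := H.one_le i
  have hN : P.val (x - algebraMap k F (ρ i)) ^ ((p - 1) * (l i + 1)) =
      P.val (x - algebraMap k F (ρ i)) ^ (((p - 1) * (l i + 1) : ℤ)) := by
    rw [← zpow_natCast]
    push_cast [Nat.cast_sub (by omega : 1 ≤ p)]
    rfl
  -- With p a - l_i b = 1 the function ξ^a y^b has v^p = v(ξ), so it is a local parameter. Here b is
  -- (p - 1) times an inverse of l_i modulo p.
  obtain ⟨b, a, hbp, hab⟩ : ∃ b a : ℕ, ¬ p ∣ b ∧ p * a = 1 + l i * b := by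
    obtain ⟨m, hm⟩ := Nat.exists_mul_mod_eq_one_of_coprime (H.coprime i) H.prime.one_lt
    obtain ⟨a, ha⟩ : p ∣ 1 + l i * ((p - 1) * m) := by
      have : 1 + l i * ((p - 1) * m) = p * (l i * m) - (l i * m - 1) := by
        have h1 : 1 ≤ l i * m := by
          rcases Nat.eq_zero_or_pos (l i * m) with h2 | h2
          · simp [h2] at hm
          · exact h2
        obtain ⟨q, hq⟩ := Nat.exists_eq_add_of_le' (by omega : 1 ≤ p)
        have h2 : l i * ((p - 1) * m) = (p - 1) * (l i * m) := by ring
        rw [h2]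
        subst hq
        simp only [Nat.add_sub_cancel, add_mul, one_mul]
        omega
      rw [this]
      refine Nat.dvd_sub (dvd_mul_right _ _) ⟨l i * m / p, ?_⟩
      have := Nat.div_add_mod (l i * m) p
      omega
    refine ⟨(p - 1) * m, a, fun hd => ?_, ha.symm⟩
    have h1 : p ∣ 1 := (Nat.dvd_add_left (hd.mul_left (l i))).1 ⟨a, ha⟩
    exact H.prime.one_lt.ne' (Nat.dvd_one.1 h1)
  have ha0 : 1 ≤ a := by
    rcases Nat.eq_zero_or_pos a with rfl | h2
    · omega
    · exact h2
  have hb0 : 1 ≤ b := by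
    rcases Nat.eq_zero_or_pos b with rfl | h2
    · simp at hbp
    · exact h2
  have hab' : (p : ℤ) * a = 1 + l i * b := by exact_mod_cast hab
  set ξ := x - algebraMap k F (ρ i) with hξ
  set η := aeval x (psi ρ l f) / aeval x (∏ i, (X - C (ρ i)) ^ (l i + 1)) with hη
  have hvpow : ∀ n : ℕ, P.val (ξ ^ n) = P.val ξ ^ (n : ℤ) := fun n => by
    rw [map_pow, zpow_natCast]
  refine ⟨ξ ^ a * y ^ b, b * (ξ ^ a * η * y ^ (b - 1)) + a * (ξ ^ (a - 1) * y ^ b), ?_, ?_, ?_⟩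
  · rw [← P.val_le_one_iff, ← pow_le_one_iff_of_nonneg zero_le H.prime.ne_zero,
      H.val_mul_pow_of_eq P h (hvpow a), ← zpow_zero (P.val ξ),
      zpow_le_zpow_iff_right_of_lt_one₀ h0 h]
    linarith
  · have hDξ : KaehlerDifferential.D k F ξ = KaehlerDifferential.D k F x := by simp [hξ]
    rw [Derivation.leibniz, Derivation.leibniz_pow, Derivation.leibniz_pow, hDξ, H.D_y,
      ← Nat.cast_smul_eq_nsmul F, ← Nat.cast_smul_eq_nsmul F]
    simp only [smul_smul, ← add_smul]
    congr 1
    ring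
  · have h1 : P.val (ξ ^ a * η) = P.val ξ ^ ((a : ℤ) + -(l i + 1 : ℤ)) := by
      rw [map_mul, hη, H.val_dy P h, hvpow, zpow_add₀ h0.ne']
    have hb1 : P.val (b : F) = 1 := by
      have := P.val_algebraMap (c := (b : k)) (by rwa [Ne, CharP.cast_eq_zero_iff k p])
      rwa [map_natCast] at this
    have h2 : P.val (b * (ξ ^ a * η * y ^ (b - 1))) ^ p =
        P.val ξ ^ (-((p - 1) * (l i + 1)) : ℤ) := by
      rw [map_mul, hb1, one_mul, H.val_mul_pow_of_eq P h h1]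
      congr 1
      push_cast [Nat.cast_sub hb0]
      linarith
    have h3 : P.val (a * (ξ ^ (a - 1) * y ^ b)) ^ p ≤ P.val ξ ^ (1 - p : ℤ) := by
      rw [map_mul, mul_pow, H.val_mul_pow_of_eq P h (hvpow (a - 1))]
      refine (mul_le_of_le_one_left' (pow_le_one₀ zero_le (P.val_natCast_le a))).trans
        (le_of_eq ?_)
      congr 1
      push_cast [Nat.cast_sub ha0]
      linarith
    -- The term in which y is differentiated dominates, its coefficient b being a unit: its exponent
    -- -(p-1)(l_i+1) is smaller than 1 - p.
    have h4 : P.val (a * (ξ ^ (a - 1) * y ^ b)) < P.val (b * (ξ ^ a * η * y ^ (b - 1))) := by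
      refine lt_of_pow_lt_pow_left₀ p zero_le (h3.trans_lt ?_)
      rw [h2, zpow_lt_zpow_iff_right_of_lt_one₀ h0 h]
      have : (2 : ℤ) * 1 ≤ (p - 1) * l i := mul_le_mul (by omega) (by omega) (by omega) (by omega)
      linarith
    rw [P.val.map_add_eq_of_lt_left h4, h2, hN, ← zpow_add₀ h0.ne',
      neg_add_cancel, zpow_zero]

/-- Necessity is the bound on derivatives of regular functions. For sufficiency g dx = (g/t') dt
with t a local parameter, and the condition says that g/t' is regular. -/
theorem mem_differentials_of_eq [CharP k p] (H : IsCover p ρ l f x y) (P : CurvePoint k F)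
    {i : Fin r} (h : P.val (x - algebraMap k F (ρ i)) < 1) {g : F} :
    g • KaehlerDifferential.D k F x ∈ P.differentials ↔
      P.val g ^ p * P.val (x - algebraMap k F (ρ i)) ^ ((p - 1) * (l i + 1)) ≤ 1 := by
  constructor
  · intro hg
    obtain ⟨g', hg', e⟩ := P.exists_eq_smul_of_mem_differentials
      (P.valPowLe p (P.val (x - algebraMap k F (ρ i)) ^ ((p - 1) * (l i + 1))) H.prime.ne_zero)
      (fun c hc s hs => by
        rw [CurvePoint.mem_valPowLe] at hs ⊢
        rw [map_mul, mul_pow, mul_assoc]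
        exact mul_le_one' (pow_le_one₀ zero_le (P.val_le_one_iff.2 hc)) hs)
      (fun _ => H.exists_D_eq_smul_of_eq P h) hg
    rwa [smul_left_injective F H.D_ne_zero e]
  · intro hg
    obtain ⟨t, t', ht, e, ht'⟩ := H.exists_parameter P h
    have ht0 : t' ≠ 0 := by
      rintro rfl
      simp [H.prime.ne_zero] at ht'
    have hv : P.val g ^ p * P.val (x - algebraMap k F (ρ i)) ^ ((p - 1) * (l i + 1)) =
        P.val (g / t') ^ p := by
      rw [map_div₀, div_pow, eq_div_iff (pow_ne_zero _ ((P.val.ne_zero_iff).2 ht0)), mul_assoc,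
        mul_comm (_ ^ _) (P.val t' ^ p), ht', mul_one]
    rw [hv, pow_le_one_iff_of_nonneg zero_le H.prime.ne_zero] at hg
    have e2 : g • KaehlerDifferential.D k F x = (g / t') • KaehlerDifferential.D k F t := by
      rw [e, smul_smul, div_mul_cancel₀ _ ht0]
    rw [e2]
    exact P.smul_D_mem_differentials (P.val_le_one_iff.1 hg) ht

end IsCover

/-! ### Coefficientwise regularity and the exponents m -/

/-- Together with `mul_m_le` this characterizes m_i^{(μ)} as the ceiling of (p-1-μ) l_i / p. -/
theorem le_mul_m {p : ℕ} (hp : 0 < p) (μ l : ℕ) :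
    (p - 1 - μ) * l ≤ p * m p μ l := by
  have := Nat.div_add_mod ((p - 1 - μ) * l + (p - 1)) p
  have := Nat.mod_lt ((p - 1 - μ) * l + (p - 1)) hp
  unfold m
  omega

theorem mul_m_le (p μ l : ℕ) : p * m p μ l ≤ (p - 1 - μ) * l + (p - 1) :=
  Nat.mul_div_le _ _

theorem natDegree_g (p : ℕ) (ρ : Fin r → k) (l : Fin r → ℕ) (μ : ℕ) :
    (g p ρ l μ).natDegree = t p l μ :=
  natDegree_prod_sub_pow ρ _

theorem g_ne_zero (p : ℕ) (ρ : Fin r → k) (l : Fin r → ℕ) (μ : ℕ) : g p ρ l μ ≠ 0 :=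
  (prod_monic ρ _).ne_zero

namespace IsCover

variable {p : ℕ} {ρ : Fin r → k} {l : Fin r → ℕ} {f : k[X]} {x y : F}

theorem zpow_le_one_iff (H : IsCover p ρ l f x y) (P : CurvePoint k F) {c : k}
    (h : P.val (x - algebraMap k F c) < 1) {n : ℤ} :
    P.val (x - algebraMap k F c) ^ n ≤ 1 ↔ 0 ≤ n := by
  rw [← zpow_zero (P.val (x - algebraMap k F c)), zpow_le_zpow_iff_right_of_lt_one₀
    (zero_lt_iff.2 ((P.val.ne_zero_iff).2 (H.sub_ne_zero c))) h]

theorem val_zpow_le_one_iff_of_infty (P : CurvePoint k F) (h : 1 < P.val x) {n : ℤ} :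
    P.val x ^ n ≤ 1 ↔ n ≤ 0 := by
  rw [← zpow_zero (P.val x), zpow_le_zpow_iff_right₀ h]

theorem val_g_of_eq (H : IsCover p ρ l f x y) (P : CurvePoint k F) {i : Fin r}
    (h : P.val (x - algebraMap k F (ρ i)) < 1) (μ : ℕ) :
    P.val (aeval x (g p ρ l μ)) = P.val (x - algebraMap k F (ρ i)) ^ (m p μ (l i) : ℤ) := by
  rw [zpow_natCast]
  exact val_aeval_prod_of_eq P H.injective h _

theorem val_g_of_ne (_ : IsCover p ρ l f x y) (P : CurvePoint k F) {c : k}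
    (h : P.val (x - algebraMap k F c) < 1) (hc : ∀ i, ρ i ≠ c) (μ : ℕ) :
    P.val (aeval x (g p ρ l μ)) = 1 :=
  val_aeval_prod_of_ne P h hc _

theorem val_g_of_infty (_ : IsCover p ρ l f x y) (P : CurvePoint k F)
    (h : 1 < P.val x) (μ : ℕ) :
    P.val (aeval x (g p ρ l μ)) = P.val x ^ (t p l μ : ℤ) := by
  rw [P.val_aeval_eq_pow_natDegree h (g_ne_zero p ρ l μ), natDegree_g, zpow_natCast]

theorem val_y_of_ne (H : IsCover p ρ l f x y) (P : CurvePoint k F) {c : k}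
    (h : P.val (x - algebraMap k F c) < 1) (hc : ∀ i, ρ i ≠ c) : P.val y ≤ 1 :=
  H.y_mem_of_mem P (H.equation_mem_of_ne P h hc)

theorem val_y_of_infty (H : IsCover p ρ l f x y) (P : CurvePoint k F)
    (h : 1 < P.val x) : P.val y ≤ 1 :=
  H.y_mem_of_mem P (H.equation_mem_of_infty P h)

/-! #### Local conditions on coefficients -/

/-- Over ρ_i the condition is p e ≥ l_i μ, and the ceiling of l_i μ / p is m_i^{(p-1-μ)}. The
hypothesis concerns the whole fibre, because interpolation at unramified points uses the conjugates.
-/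
theorem val_coeff_div_le [CharP k p] (H : IsCover p ρ l f x y) {c : k} {a : ℕ → F}
    (ha : ∀ μ, a μ ∈ IntermediateField.adjoin k {x})
    (hreg : ∀ P : CurvePoint k F, P.val (x - algebraMap k F c) < 1 →
      ∑ μ ∈ Finset.range p, a μ * y ^ μ ∈ P.localRing)
    (P : CurvePoint k F) (h : P.val (x - algebraMap k F c) < 1) {μ : ℕ} (hμ : μ < p) :
    P.val (a μ / aeval x (g p ρ l (p - 1 - μ))) ≤ 1 := by
  by_cases hc : ∀ i, ρ i ≠ c
  · rw [map_div₀, H.val_g_of_ne P h hc, div_one]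
    exact H.val_coeff_le_of_ne P h hc ha hreg hμ
  · push Not at hc
    obtain ⟨i, rfl⟩ := hc
    by_cases h0 : a μ = 0
    · simp [h0]
    obtain ⟨e, he⟩ := P.exists_val_eq_zpow (H.sub_ne_zero _) h (ha μ) h0
    have h1 := (H.val_le_val_sum P h ha hμ).trans (P.val_le_one_iff.2 (hreg P h))
    have h2 := pow_le_one₀ (n := p) zero_le h1
    rw [H.val_mul_pow_of_eq P h he, H.zpow_le_one_iff P h] at h2
    rw [map_div₀, he, H.val_g_of_eq P h, ← zpow_sub₀ ((P.val.ne_zero_iff).2 (H.sub_ne_zero _)),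
      H.zpow_le_one_iff P h]
    have h3 := mul_m_le p (p - 1 - μ) (l i)
    rw [Nat.sub_sub_self (by omega)] at h3
    have h4 : (p : ℤ) * m p (p - 1 - μ) (l i) < μ * l i + p := by
      have := H.prime.pos
      exact_mod_cast (by omega : p * m p (p - 1 - μ) (l i) < μ * l i + p)
    have h5 : (p : ℤ) * m p (p - 1 - μ) (l i) < p * (e + 1) := by linarith
    have := lt_of_mul_lt_mul_left h5 (by positivity)
    omega

theorem val_coeff_mul_le [IsAlgClosed k] [CharP k p] (H : IsCover p ρ l f x y) {c : k}
    {b : ℕ → F} (hb : ∀ μ, b μ ∈ IntermediateField.adjoin k {x})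
    (hreg : ∀ P : CurvePoint k F, P.val (x - algebraMap k F c) < 1 →
      (∑ μ ∈ Finset.range p, b μ * y ^ μ) • KaehlerDifferential.D k F x ∈ P.differentials)
    (P : CurvePoint k F) (h : P.val (x - algebraMap k F c) < 1) {μ : ℕ} (hμ : μ < p) :
    P.val (b μ * aeval x (g p ρ l μ)) ≤ 1 := by
  by_cases hc : ∀ i, ρ i ≠ c
  · rw [map_mul, H.val_g_of_ne P h hc, mul_one]
    exact H.val_coeff_le_of_ne P h hc hb (fun P' h' => P'.val_le_one_iff.1
      ((H.mem_differentials_of_ne P' h' hc).1 (hreg P' h'))) hμ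
  · push Not at hc
    obtain ⟨i, rfl⟩ := hc
    by_cases h0 : b μ = 0
    · simp [h0]
    obtain ⟨e, he⟩ := P.exists_val_eq_zpow (H.sub_ne_zero _) h (hb μ) h0
    have hne := (P.val.ne_zero_iff).2 (H.sub_ne_zero (ρ i))
    have h2 := (mul_le_mul_left (pow_le_pow_left₀ zero_le (H.val_le_val_sum P h hb hμ) p)
      _).trans ((H.mem_differentials_of_eq P h).1 (hreg P h))
    have hp1 := H.prime.pos
    rw [H.val_mul_pow_of_eq P h he, ← zpow_natCast, ← zpow_add₀ hne, H.zpow_le_one_iff P h] at h2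
    rw [map_mul, he, H.val_g_of_eq P h, ← zpow_add₀ hne, H.zpow_le_one_iff P h]
    have h3 := le_mul_m hp1 μ (l i)
    have h3' : (((p - 1 - μ) * l i : ℕ) : ℤ) ≤ p * m p μ (l i) := by exact_mod_cast h3
    push_cast [Nat.cast_sub (by omega : μ ≤ p - 1), Nat.cast_sub (by omega : 1 ≤ p)] at h2 h3'
    -- Regularity gives p(e + m) ≥ -(p - 1) > -p, and e + m is an integer.
    have h5 : (p : ℤ) * (-1) < p * (e + m p μ (l i)) := by linarith
    have := lt_of_mul_lt_mul_left h5 (by positivity)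
    omega

/-! #### Regularity of the basic functions and differentials -/

theorem val_base_le (H : IsCover p ρ l f x y) (P : CurvePoint k F) {c : k}
    (h : P.val (x - algebraMap k F c) < 1) {μ : ℕ} (hμ : μ < p) :
    P.val (aeval x (g p ρ l (p - 1 - μ)) * y ^ μ) ≤ 1 := by
  by_cases hc : ∀ i, ρ i ≠ c
  · rw [map_mul, map_pow, H.val_g_of_ne P h hc, one_mul]
    exact pow_le_one₀ zero_le (H.val_y_of_ne P h hc)
  · push Not at hc
    obtain ⟨i, rfl⟩ := hc
    rw [← pow_le_one_iff_of_nonneg zero_le H.prime.ne_zero,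
      H.val_mul_pow_of_eq P h (H.val_g_of_eq P h _), H.zpow_le_one_iff P h]
    have h3 := le_mul_m H.prime.pos (p - 1 - μ) (l i)
    rw [Nat.sub_sub_self (by omega)] at h3
    have h3' : (μ * l i : ℤ) ≤ p * m p (p - 1 - μ) (l i) := by exact_mod_cast h3
    linarith

theorem base_mem_differentials [IsAlgClosed k] [CharP k p] (H : IsCover p ρ l f x y)
    (P : CurvePoint k F) {c : k} (h : P.val (x - algebraMap k F c) < 1) {μ : ℕ} (hμ : μ < p)
    {z : F} (hz : P.val z ≤ 1) :
    (z * (y ^ μ / aeval x (g p ρ l μ))) • KaehlerDifferential.D k F x ∈ P.differentials := by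
  by_cases hc : ∀ i, ρ i ≠ c
  · rw [H.mem_differentials_of_ne P h hc, map_mul, map_div₀, map_pow, H.val_g_of_ne P h hc,
      div_one]
    exact mul_le_one' hz (pow_le_one₀ zero_le (H.val_y_of_ne P h hc))
  · push Not at hc
    obtain ⟨i, rfl⟩ := hc
    have hne := (P.val.ne_zero_iff).2 (H.sub_ne_zero (ρ i))
    have e : y ^ μ / aeval x (g p ρ l μ) = (aeval x (g p ρ l μ))⁻¹ * y ^ μ := by
      rw [div_eq_inv_mul]
    have hv : P.val (aeval x (g p ρ l μ))⁻¹ =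
        P.val (x - algebraMap k F (ρ i)) ^ (-(m p μ (l i) : ℤ)) := by
      rw [map_inv₀, H.val_g_of_eq P h, zpow_neg]
    rw [H.mem_differentials_of_eq P h, map_mul, mul_pow, mul_assoc, e,
      H.val_mul_pow_of_eq P h hv, ← zpow_natCast _ ((p - 1) * (l i + 1)), ← zpow_add₀ hne]
    refine mul_le_one' (pow_le_one₀ zero_le hz) ((H.zpow_le_one_iff P h).2 ?_)
    have hp1 := H.prime.pos
    have h3 := mul_m_le p μ (l i)
    have h3' : (p : ℤ) * m p μ (l i) ≤ (((p - 1 - μ) * l i + (p - 1) : ℕ) : ℤ) := by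
      exact_mod_cast h3
    push_cast [Nat.cast_sub (by omega : μ ≤ p - 1), Nat.cast_sub (by omega : 1 ≤ p)] at h3' ⊢
    linarith

/-- Above ∞ the factor 1/g_μ gains t^{(μ)} orders and dx costs two, which leaves room for growth
like x^(t-2). -/
theorem base_mem_differentials_of_infty [IsAlgClosed k] [CharP k p] (H : IsCover p ρ l f x y)
    (P : CurvePoint k F) (h : 1 < P.val x) (μ : ℕ) {z : F}
    (hz : P.val z ≤ P.val x ^ ((t p l μ : ℤ) - 2)) :
    (z * (y ^ μ / aeval x (g p ρ l μ))) • KaehlerDifferential.D k F x ∈ P.differentials := by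
  have h0 : P.val x ≠ 0 := (zero_lt_one.trans h).ne'
  rw [H.mem_differentials_of_infty P h, map_mul, map_mul, map_div₀, map_pow, map_pow,
    H.val_g_of_infty P h]
  calc P.val z * (P.val y ^ μ / P.val x ^ (t p l μ : ℤ)) * P.val x ^ 2
      ≤ P.val x ^ ((t p l μ : ℤ) - 2) * (1 / P.val x ^ (t p l μ : ℤ)) * P.val x ^ 2 := by
        gcongr
        · exact zero_le
        · exact pow_le_one₀ zero_le (H.val_y_of_infty P h)
    _ = 1 := by
        rw [zpow_sub₀ h0]
        have : P.val x ^ (t p l μ : ℤ) ≠ 0 := zpow_ne_zero _ h0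
        field_simp

/-! #### The points of the standard open sets -/

theorem exists_of_mem_openInfty [IsAlgClosed k] (H : IsCover p ρ l f x y) {P : CurvePoint k F}
    (hP : P ∈ openInfty k x) : ∃ c : k, P.val (x - algebraMap k F c) < 1 :=
  H.exists_center P (not_not.1 hP)

theorem exists_or_of_mem_openZero [IsAlgClosed k] (H : IsCover p ρ l f x y) {P : CurvePoint k F}
    (hP : P ∈ openZero k x) :
    (∃ c : k, c ≠ 0 ∧ P.val (x - algebraMap k F c) < 1) ∨ 1 < P.val x := by
  by_cases hx : x ∈ P.localRing
  · obtain ⟨c, hc⟩ := H.exists_center P hx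
    refine Or.inl ⟨c, ?_, hc⟩
    rintro rfl
    exact hP hc
  · rw [← P.val_le_one_iff, not_le] at hx
    exact Or.inr hx

theorem mem_openInfty (_ : IsCover p ρ l f x y) {P : CurvePoint k F} {c : k}
    (h : P.val (x - algebraMap k F c) < 1) : P ∈ openInfty k x :=
  not_not.2 (P.val_le_one_iff.1 (P.val_le_one_of_val_sub_lt h))

theorem val_eq_one (_ : IsCover p ρ l f x y) {P : CurvePoint k F} {c : k} (hc : c ≠ 0)
    (h : P.val (x - algebraMap k F c) < 1) : P.val x = 1 := by
  have := P.val_aeval_eq_one h (q := X) (by simpa using hc)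
  rwa [aeval_X] at this

theorem mem_openZero (H : IsCover p ρ l f x y) {P : CurvePoint k F} {c : k} (hc : c ≠ 0)
    (h : P.val (x - algebraMap k F c) < 1) : P ∈ openZero k x := by
  intro h'
  have h1 : P.val (x - algebraMap k F 0) < 1 := h'
  rw [map_zero, sub_zero, H.val_eq_one hc h] at h1
  exact lt_irrefl _ h1

theorem mem_openZero_of_infty (_ : IsCover p ρ l f x y) {P : CurvePoint k F}
    (h : 1 < P.val x) : P ∈ openZero k x := by
  intro h'
  have h1 : P.val (x - algebraMap k F 0) < 1 := h'
  rw [map_zero, sub_zero] at h1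
  exact lt_asymm h h1

/-! #### Laurent polynomials -/

/-- Once its factors X are removed, the denominator divides the numerator: multiplicities are
compared root by root. One point above each c suffices, as the value of an element of k(x) depends
only on its order at c. -/
theorem exists_eq_div_pow [IsAlgClosed k] (H : IsCover p ρ l f x y) {s : F}
    (hs : s ∈ IntermediateField.adjoin k {x})
    (h : ∀ c : k, c ≠ 0 → ∃ P : CurvePoint k F, P.val (x - algebraMap k F c) < 1 ∧ P.val s ≤ 1) :
    ∃ (q : k[X]) (n : ℕ), s = aeval x q / x ^ n := by
  classical
  obtain ⟨a, d, rfl⟩ := IntermediateField.mem_adjoin_simple_iff k s |>.1 hs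
  by_cases ha : a = 0
  · exact ⟨0, 0, by simp [ha]⟩
  by_cases hd : d = 0
  · exact ⟨0, 0, by simp [hd]⟩
  obtain ⟨d', hd', hX⟩ := exists_eq_pow_rootMultiplicity_mul_and_not_dvd d hd 0
  have hd'0 : d' ≠ 0 := by rintro rfl; simp at hX
  have hdvd : d' ∣ a := by
    refine (IsAlgClosed.splits d').dvd_of_roots_le_roots hd'0 (Multiset.le_iff_count.2 fun c => ?_)
    rw [count_roots, count_roots]
    by_cases hc : c = 0
    · subst hc
      rw [rootMultiplicity_eq_zero (by rwa [dvd_iff_isRoot] at hX)]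
      exact zero_le
    · obtain ⟨P, hP, hle⟩ := h c hc
      have h0 := zero_lt_iff.2 ((P.val.ne_zero_iff).2 (H.sub_ne_zero c))
      rw [map_div₀, P.val_aeval_eq_pow hP ha, P.val_aeval_eq_pow hP hd, div_le_one₀ (pow_pos h0 _),
        pow_le_pow_iff_right_of_lt_one₀ h0 hP] at hle
      refine le_trans (rootMultiplicity_le_rootMultiplicity_of_dvd hd ?_ c) hle
      exact Dvd.intro_left _ hd'.symm
  obtain ⟨q, rfl⟩ := hdvd
  refine ⟨q, d.rootMultiplicity 0, ?_⟩
  have e := congrArg (aeval x) hd'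
  rw [map_zero, sub_zero, map_mul, map_pow, aeval_X] at e
  have := H.aeval_ne_zero hd'0
  have := H.ne_zero
  rw [e, map_mul]
  field_simp

/-- A rational function of `x` which is regular away from `0` and `∞` is a combination of powers of
`x`, whose exponents are bounded by the orders at `0` and `∞`. -/
theorem mem_span_zpow [IsAlgClosed k] (H : IsCover p ρ l f x y) {s : F}
    (hs : s ∈ IntermediateField.adjoin k {x})
    (h : ∀ c : k, c ≠ 0 → ∃ P : CurvePoint k F, P.val (x - algebraMap k F c) < 1 ∧ P.val s ≤ 1)
    (A B : Prop) (d : ℤ)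
    (hA : A → ∃ P : CurvePoint k F, P.val (x - algebraMap k F 0) < 1 ∧ P.val s ≤ 1)
    (hB : B → ∃ P : CurvePoint k F, 1 < P.val x ∧ P.val s ≤ P.val x ^ d) :
    s ∈ Submodule.span k {z : F | ∃ j : ℤ, (A → 0 ≤ j) ∧ (B → j ≤ d) ∧ z = x ^ j} := by
  obtain ⟨q, n, rfl⟩ := H.exists_eq_div_pow hs h
  by_cases hq : q = 0
  · simp [hq]
  have hx := H.ne_zero
  rw [aeval_eq_sum_range, Finset.sum_div]
  refine Submodule.sum_mem _ fun i hi => ?_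
  by_cases hi0 : q.coeff i = 0
  · simp [hi0]
  rw [smul_div_assoc]
  refine Submodule.smul_mem _ _ (Submodule.subset_span ⟨i - n, fun hA' => ?_, fun hB' => ?_, ?_⟩)
  · obtain ⟨P, hP, hle⟩ := hA hA'
    have h0 := zero_lt_iff.2 ((P.val.ne_zero_iff).2 (H.sub_ne_zero 0))
    have h1 := P.val_aeval_eq_pow hP hq
    rw [map_zero, sub_zero] at h1 h0 hP
    rw [map_div₀, h1, map_pow, div_le_one₀ (pow_pos h0 _),
      pow_le_pow_iff_right_of_lt_one₀ h0 hP, rootMultiplicity_eq_natTrailingDegree'] at hle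
    have := natTrailingDegree_le_of_ne_zero hi0
    omega
  · obtain ⟨P, hP, hle⟩ := hB hB'
    have h0 : 0 < P.val x := zero_lt_one.trans hP
    rw [map_div₀, P.val_aeval_eq_pow_natDegree hP hq, map_pow, ← zpow_natCast, ← zpow_natCast,
      ← zpow_sub₀ h0.ne', zpow_le_zpow_iff_right₀ hP] at hle
    have := Finset.mem_range.1 hi
    omega
  · rw [zpow_sub₀ hx, zpow_natCast, zpow_natCast]

/-! #### Bases of the spaces of functions and differentials -/

/-- The functions `x ^ j g_{p-1-μ}(x) y ^ μ`. -/
noncomputable def baseFun (p : ℕ) (ρ : Fin r → k) (l : Fin r → ℕ) (x y : F) (i : ℤ × Fin p) : F :=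
  x ^ i.1 * (aeval x (g p ρ l (p - 1 - i.2)) * y ^ (i.2 : ℕ))

/-- The differentials `x ^ j y ^ μ / g_μ(x) dx`, without the `dx`. -/
noncomputable def baseForm (p : ℕ) (ρ : Fin r → k) (l : Fin r → ℕ) (x y : F) (i : ℤ × Fin p) : F :=
  x ^ i.1 * (y ^ (i.2 : ℕ) / aeval x (g p ρ l i.2))

/-- Distinct powers of x have distinct values at a point above ∞. -/
theorem linearIndependent_zpow (H : IsCover p ρ l f x y) :
    LinearIndependent k fun j : ℤ => x ^ j := by
  obtain ⟨P, hP⟩ := H.exists_point_infty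
  have h0 : 0 < P.val x := zero_lt_one.trans hP
  have hx := H.ne_zero
  rw [linearIndependent_iff']
  intro s c hc j hj
  have h1 := P.val.le_sum_of_pairwise_ne s (fun j => c j • x ^ j) ?_ j hj
  · rw [hc, map_zero, le_zero_iff, P.val.zero_iff] at h1
    exact (smul_eq_zero.1 h1).resolve_right (zpow_ne_zero _ hx)
  · intro i _ j _ hij hi hj e
    have h2 : ∀ j, c j • x ^ j ≠ 0 → P.val (c j • x ^ j) = P.val x ^ j := fun j hj => by
      rw [Algebra.smul_def, map_mul, P.val_algebraMap (left_ne_zero_of_smul hj), one_mul,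
        map_zpow₀]
    rw [h2 i hi, h2 j hj] at e
    exact hij (zpow_right_injective₀ h0 hP.ne' e)

theorem linearIndependent_zpow_mul (H : IsCover p ρ l f x y) {c : Fin p → F}
    (hc : ∀ μ, c μ ∈ IntermediateField.adjoin k {x}) (hc0 : ∀ μ, c μ ≠ 0) :
    LinearIndependent k fun i : ℤ × Fin p => x ^ i.1 * (c i.2 * y ^ (i.2 : ℕ)) := by
  let K := IntermediateField.adjoin k {x}
  let b : ℤ → K := fun j => ⟨x ^ j, zpow_mem H.self_mem j⟩
  have hb : LinearIndependent k b :=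
    LinearIndependent.of_comp K.val.toLinearMap H.linearIndependent_zpow
  have hy : LinearIndependent K fun μ : Fin p => c μ * y ^ (μ : ℕ) := by
    rw [Fintype.linearIndependent_iff]
    intro a ha μ
    have h1 := H.eq_zero_of_sum_eq_zero (a := fun μ => if h : μ < p then (a ⟨μ, h⟩ : F) * c ⟨μ, h⟩
      else 0) (fun μ => by split_ifs; exacts [mul_mem (SetLike.coe_mem _) (hc _), zero_mem _]) ?_
      μ.2
    · simpa [hc0] using h1
    · rw [Finset.sum_range, ← ha]
      refine Finset.sum_congr rfl fun μ _ => ?_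
      simp only [Fin.is_lt, dite_true, Fin.eta, mul_assoc]
      rfl
  have h := linearIndependent_smul hb hy
  have e : (fun i : ℤ × Fin p => b i.1 • (c i.2 * y ^ (i.2 : ℕ))) =
      fun i => x ^ i.1 * (c i.2 * y ^ (i.2 : ℕ)) := funext fun i => Algebra.smul_def _ _
  rwa [e] at h

theorem linearIndependent_baseFun (H : IsCover p ρ l f x y) :
    LinearIndependent k (baseFun p ρ l x y) :=
  H.linearIndependent_zpow_mul (c := fun μ => aeval x (g p ρ l (p - 1 - μ)))
    (fun _ => H.aeval_mem _) (fun _ => H.aeval_ne_zero (g_ne_zero _ _ _ _))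

theorem linearIndependent_baseForm (H : IsCover p ρ l f x y) :
    LinearIndependent k (baseForm p ρ l x y) := by
  have := H.linearIndependent_zpow_mul (c := fun μ => (aeval x (g p ρ l μ))⁻¹)
    (fun _ => inv_mem (H.aeval_mem _)) (fun _ => inv_ne_zero (H.aeval_ne_zero (g_ne_zero _ _ _ _)))
  convert this using 2 with i
  rw [baseForm, div_eq_inv_mul]

/-- The propositions `A` and `B` act as switches for regularity above 0 and above ∞, so that one
statement gives the functions on U_0 ∩ U_∞, U_∞, U_0 and X. -/
theorem mem_span_baseFun [IsAlgClosed k] [CharP k p] (H : IsCover p ρ l f x y) (A B : Prop) {h : F}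
    (hh : h ∈ regularFunctions (openZero k x ∩ openInfty k x))
    (hA : A → h ∈ regularFunctions (openInfty k x))
    (hB : B → h ∈ regularFunctions (openZero k x)) :
    h ∈ Submodule.span k (baseFun p ρ l x y '' {i | (A → 0 ≤ i.1) ∧
      (B → i.1 ≤ -(t p l (p - 1 - i.2) : ℤ))}) := by
  obtain ⟨a, ha, rfl⟩ := H.exists_sum h
  refine Submodule.sum_mem _ fun μ hμ => ?_
  rw [Finset.mem_range] at hμ
  have hg := H.aeval_ne_zero (g_ne_zero p ρ l (p - 1 - μ))
  have key := H.mem_span_zpow (s := a μ / aeval x (g p ρ l (p - 1 - μ)))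
    (div_mem (ha μ) (H.aeval_mem _)) (fun c hc => ?_) A B (-(t p l (p - 1 - μ) : ℤ))
    (fun hA' => ?_) (fun hB' => ?_)
  · let T : F →ₗ[k] F := LinearMap.mulRight k (aeval x (g p ρ l (p - 1 - μ)) * y ^ μ)
    have h1 := Submodule.mem_map_of_mem (f := T) key
    rw [Submodule.map_span] at h1
    have e : T (a μ / aeval x (g p ρ l (p - 1 - μ))) = a μ * y ^ μ := by
      simp only [T, LinearMap.mulRight_apply]
      field_simp
    rw [e] at h1
    refine Submodule.span_mono ?_ h1
    rintro _ ⟨_, ⟨j, hj1, hj2, rfl⟩, rfl⟩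
    exact ⟨(j, ⟨μ, hμ⟩), ⟨hj1, hj2⟩, rfl⟩
  · obtain ⟨P, hP⟩ := H.exists_point c
    exact ⟨P, hP, H.val_coeff_div_le ha
      (fun P' h' => hh P' ⟨H.mem_openZero hc h', H.mem_openInfty h'⟩) P hP hμ⟩
  · obtain ⟨P, hP⟩ := H.exists_point 0
    exact ⟨P, hP, H.val_coeff_div_le ha (fun P' h' => hA hA' P' (H.mem_openInfty h')) P hP hμ⟩
  · obtain ⟨P, hP⟩ := H.exists_point_infty
    refine ⟨P, hP, ?_⟩
    rw [map_div₀, H.val_g_of_infty P hP, zpow_neg, div_eq_mul_inv]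
    exact mul_le_of_le_one_left' (H.val_coeff_le_of_infty P hP ha
      (fun P' h' => hB hB' P' (H.mem_openZero_of_infty h')) hμ)

theorem mem_span_baseForm [IsAlgClosed k] [CharP k p] (H : IsCover p ρ l f x y) {h : F}
    (h0 : h • KaehlerDifferential.D k F x ∈ regularDifferentials (openZero k x))
    (h1 : h • KaehlerDifferential.D k F x ∈ regularDifferentials (openInfty k x)) :
    h ∈ Submodule.span k (baseForm p ρ l x y '' {i | 0 ≤ i.1 ∧ i.1 ≤ (t p l i.2 : ℤ) - 2}) := by
  obtain ⟨b, hb, rfl⟩ := H.exists_sum h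
  refine Submodule.sum_mem _ fun μ hμ => ?_
  rw [Finset.mem_range] at hμ
  have hg := H.aeval_ne_zero (g_ne_zero p ρ l μ)
  have hfin : ∀ c : k, ∃ P : CurvePoint k F, P.val (x - algebraMap k F c) < 1 ∧
      P.val (b μ * aeval x (g p ρ l μ)) ≤ 1 := fun c => by
    obtain ⟨P, hP⟩ := H.exists_point c
    exact ⟨P, hP, H.val_coeff_mul_le hb (fun P' h' => h1 P' (H.mem_openInfty h')) P hP hμ⟩
  have key := H.mem_span_zpow (s := b μ * aeval x (g p ρ l μ))
    (mul_mem (hb μ) (H.aeval_mem _)) (fun c _ => hfin c) True True ((t p l μ : ℤ) - 2)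
    (fun _ => hfin 0) (fun _ => ?_)
  · let T : F →ₗ[k] F := LinearMap.mulRight k (y ^ μ / aeval x (g p ρ l μ))
    have h1 := Submodule.mem_map_of_mem (f := T) key
    rw [Submodule.map_span] at h1
    have e : T (b μ * aeval x (g p ρ l μ)) = b μ * y ^ μ := by
      simp only [T, LinearMap.mulRight_apply]
      field_simp
    rw [e] at h1
    refine Submodule.span_mono ?_ h1
    rintro _ ⟨_, ⟨j, hj1, hj2, rfl⟩, rfl⟩
    exact ⟨(j, ⟨μ, hμ⟩), ⟨hj1 trivial, hj2 trivial⟩, rfl⟩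
  · obtain ⟨P, hP⟩ := H.exists_point_infty
    refine ⟨P, hP, ?_⟩
    -- Regularity of the differential above ∞ is regularity of the function multiplied by x², so the
    -- coefficients tested are b_μ x².
    have hv := H.val_coeff_le_of_infty P hP (a := fun μ => b μ * x ^ 2)
      (fun μ => mul_mem (hb μ) (pow_mem H.self_mem 2)) (fun P' h' => ?_) hμ
    · have hx0 : P.val x ≠ 0 := (zero_lt_one.trans hP).ne'
      rw [map_mul, map_pow] at hv
      rw [map_mul, H.val_g_of_infty P hP]
      calc P.val (b μ) * P.val x ^ (t p l μ : ℤ)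
          = P.val (b μ) * P.val x ^ 2 * P.val x ^ ((t p l μ : ℤ) - 2) := by
            rw [mul_assoc, ← zpow_natCast _ 2, ← zpow_add₀ hx0]
            congr 2
            push_cast
            ring
        _ ≤ _ := mul_le_of_le_one_left' hv
    · have := (H.mem_differentials_of_infty P' h').1 (h0 P' (H.mem_openZero_of_infty h'))
      rw [P'.val_le_one_iff, Finset.sum_mul] at this
      convert this using 2 with ν _
      ring

theorem baseFun_mem [IsAlgClosed k] (H : IsCover p ρ l f x y) (i : ℤ × Fin p) :
    baseFun p ρ l x y i ∈ regularFunctions (openZero k x ∩ openInfty k x) := by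
  intro P hP
  rcases H.exists_or_of_mem_openZero hP.1 with ⟨c, hc, h⟩ | h
  · rw [← P.val_le_one_iff, baseFun, map_mul, map_zpow₀, H.val_eq_one hc h, one_zpow, one_mul]
    exact H.val_base_le P h i.2.2
  · obtain ⟨c, hc⟩ := H.exists_of_mem_openInfty hP.2
    exact absurd (P.val_le_one_of_val_sub_lt hc) (not_le.2 h)

theorem baseFun_mem_openInfty [IsAlgClosed k] (H : IsCover p ρ l f x y) {i : ℤ × Fin p}
    (hi : 0 ≤ i.1) : baseFun p ρ l x y i ∈ regularFunctions (openInfty k x) := by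
  intro P hP
  obtain ⟨c, h⟩ := H.exists_of_mem_openInfty hP
  obtain ⟨n, hn⟩ := Int.eq_ofNat_of_zero_le hi
  rw [← P.val_le_one_iff, baseFun, map_mul, hn, zpow_natCast, map_pow]
  exact mul_le_one' (pow_le_one₀ zero_le (P.val_le_one_of_val_sub_lt h)) (H.val_base_le P h i.2.2)

theorem baseFun_mem_openZero [IsAlgClosed k] (H : IsCover p ρ l f x y) {i : ℤ × Fin p}
    (hi : i.1 ≤ -(t p l (p - 1 - i.2) : ℤ)) :
    baseFun p ρ l x y i ∈ regularFunctions (openZero k x) := by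
  intro P hP
  rcases H.exists_or_of_mem_openZero hP with ⟨c, hc, h⟩ | h
  · rw [← P.val_le_one_iff, baseFun, map_mul, map_zpow₀, H.val_eq_one hc h, one_zpow, one_mul]
    exact H.val_base_le P h i.2.2
  · have hx0 : P.val x ≠ 0 := (zero_lt_one.trans h).ne'
    rw [← P.val_le_one_iff, baseFun, map_mul, map_zpow₀, map_mul, map_pow, H.val_g_of_infty P h,
      ← mul_assoc, ← zpow_add₀ hx0]
    refine mul_le_one' ((val_zpow_le_one_iff_of_infty P h).2 (by linarith)) ?_
    exact pow_le_one₀ zero_le (H.val_y_of_infty P h)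

end IsCover

/-! ### Truncations, numerical bounds and the explicit cocycles -/

theorem lowPart_add_highPart (n : ℕ) (h : k[X]) : lowPart n h + highPart n h = h := by
  conv_rhs => rw [h.as_sum_support]
  rw [lowPart, highPart, ← Finset.sum_filter_add_sum_filter_not h.support (· < n)]
  simp only [not_lt]

theorem coeff_lowPart (n : ℕ) (h : k[X]) (i : ℕ) :
    (lowPart n h).coeff i = if i < n then h.coeff i else 0 := by
  simp only [lowPart, finsetSum_coeff, coeff_monomial, Finset.sum_ite_eq', Finset.mem_filter,
    mem_support_iff]
  split_ifs <;> simp_all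

theorem X_pow_dvd_highPart (n : ℕ) (h : k[X]) : X ^ n ∣ highPart n h := by
  refine Finset.dvd_sum fun i hi => ?_
  rw [← C_mul_X_pow_eq_monomial]
  exact (pow_dvd_pow X (Finset.mem_filter.1 hi).2).mul_left _

theorem m_pred (p l : ℕ) (hp : 0 < p) : m p (p - 1) l = 0 := by
  rw [m, Nat.sub_self, zero_mul, zero_add]
  exact Nat.div_eq_of_lt (by omega)

theorem t_pred (p : ℕ) (l : Fin r → ℕ) (hp : 0 < p) : t p l (p - 1) = 0 := by
  simp [t, m_pred _ _ hp]

theorem one_le_m {p μ l : ℕ} (hμ : μ + 2 ≤ p) (hl : 1 ≤ l) : 1 ≤ m p μ l := by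
  rw [m, Nat.one_le_div_iff (by omega)]
  have : 1 * 1 ≤ (p - 1 - μ) * l := Nat.mul_le_mul (by omega) hl
  omega

theorem m_le {p μ l : ℕ} (hp : 0 < p) : m p μ l ≤ l := by
  have h1 := mul_m_le p μ l
  have h2 : (p - 1 - μ) * l ≤ (p - 1) * l := Nat.mul_le_mul_right _ (Nat.sub_le _ _)
  have h3 : p * m p μ l < p * (l + 1) := by
    obtain ⟨q, rfl⟩ := Nat.exists_eq_add_of_le' hp
    simp only [Nat.add_sub_cancel] at h1 h2
    nlinarith
  exact Nat.lt_succ_iff.1 (lt_of_mul_lt_mul_left h3 (Nat.zero_le _))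

namespace IsCover

variable {p : ℕ} {ρ : Fin r → k} {l : Fin r → ℕ} {f : k[X]} {x y : F}

theorem one_le_t (H : IsCover p ρ l f x y) {μ : ℕ} (hμ : μ + 2 ≤ p) : 1 ≤ t p l μ := by
  refine (one_le_m hμ (H.one_le ⟨0, H.pos⟩)).trans ?_
  exact Finset.single_le_sum (f := fun i => m p μ (l i)) (fun _ _ => Nat.zero_le _)
    (Finset.mem_univ _)

theorem hTilde_eq (p : ℕ) (ρ : Fin r → k) (l : Fin r → ℕ) (x y : F) {μ ν : ℕ} (hμ : 1 ≤ μ)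
    (hμp : μ ≤ p) : hTilde p ρ l x y μ ν = baseFun p ρ l x y (-(ν : ℤ), ⟨μ - 1, by omega⟩) := by
  have : p - 1 - (μ - 1) = p - μ := by omega
  rw [hTilde, baseFun, zpow_neg, zpow_natCast, this, div_eq_inv_mul]

theorem omegaHol_eq (p : ℕ) (ρ : Fin r → k) (l : Fin r → ℕ) (x y : F) {μ ν : ℕ} (hμ : μ < p)
    (hν : 1 ≤ ν) : omegaHol p ρ l x y μ ν =
      baseForm p ρ l x y ((ν : ℤ) - 1, ⟨μ, hμ⟩) • KaehlerDifferential.D k F x := by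
  have : (ν : ℤ) - 1 = (ν - 1 : ℕ) := by omega
  rw [omegaHol, baseForm, this, zpow_natCast]

theorem prod_eq_aeval (ρ : Fin r → k) (n : Fin r → ℕ) (x : F) :
    ∏ i, (x - algebraMap k F (ρ i)) ^ n i = aeval x (∏ i, (X - C (ρ i)) ^ n i) := by
  simp [map_prod]

/-- Differentiating g_{p-μ} / x^ν gives the φ-term, after multiplication and division by g_{μ-1};
differentiating y^(μ-1) and inserting dy gives the ψ-term. -/
theorem D_hTilde [CharP k p] (H : IsCover p ρ l f x y) {μ ν : ℕ} (hμ : 1 ≤ μ) (hν : 1 ≤ ν) :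
    KaehlerDifferential.D k F (hTilde p ρ l x y μ ν) =
      (aeval x (phi p ρ l μ ν) / x ^ (ν + 1)) • omegaHol p ρ l x y (μ - 1) 1
        + (aeval x (psi ρ l f) / x ^ ν) • omega p ρ l x y μ := by
  have hx := H.ne_zero
  have hg := H.aeval_ne_zero (g_ne_zero p ρ l (μ - 1))
  have hd := H.aeval_ne_zero (prod_monic ρ fun i => l i + 1).ne_zero
  rw [hTilde, Derivation.leibniz_div, Derivation.leibniz, Derivation.leibniz_pow,
    Derivation.leibniz_pow, H.D_y, CurvePoint.D_aeval, omegaHol, omega,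
    prod_eq_aeval ρ (fun i => l i + 1), ← Nat.cast_smul_eq_nsmul F, ← Nat.cast_smul_eq_nsmul F]
  simp only [smul_smul, ← add_smul, ← sub_smul]
  congr 1
  have e1 : aeval x (phi p ρ l μ ν) = x * aeval x (derivative (g p ρ l (p - μ))) *
      aeval x (g p ρ l (μ - 1)) - ν * aeval x (g p ρ l (p - μ)) * aeval x (g p ρ l (μ - 1)) := by
    simp [phi]
  obtain ⟨n, rfl⟩ := Nat.exists_eq_add_of_le' hν
  obtain ⟨a, rfl⟩ := Nat.exists_eq_add_of_le' hμ
  have e2 : a + 1 - 2 = a - 1 := by omega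
  rw [e1, e2]
  generalize aeval x (∏ i, (X - C (ρ i)) ^ (l i + 1)) = d at hd ⊢
  simp only [Nat.add_sub_cancel] at hg
  simp only [Nat.add_sub_cancel, Nat.sub_self, pow_zero, one_mul, Nat.cast_add, Nat.cast_one,
    add_sub_cancel_right]
  field_simp
  ring

/-! #### The explicit cocycles -/

theorem val_lowPart_le_of_infty (_ : IsCover p ρ l f x y) (P : CurvePoint k F) (h : 1 < P.val x)
    {q : k[X]} {n : ℕ} {e : ℤ} (hq : ∀ i, q.coeff i ≠ 0 → (i : ℤ) ≤ e) :
    P.val (aeval x q / x ^ n) ≤ P.val x ^ (e - n) := by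
  have h0 : 0 < P.val x := zero_lt_one.trans h
  by_cases hq0 : q = 0
  · simp [hq0]
  rw [map_div₀, P.val_aeval_eq_pow_natDegree h hq0, map_pow, ← zpow_natCast, ← zpow_natCast,
    ← zpow_sub₀ h0.ne', zpow_le_zpow_iff_right₀ h]
  have := hq _ (leadingCoeff_ne_zero.2 hq0)
  omega

theorem val_highPart_le (H : IsCover p ρ l f x y) (P : CurvePoint k F) (h : P.val x ≤ 1)
    (q : k[X]) (n : ℕ) : P.val (aeval x (highPart n q) / x ^ n) ≤ 1 := by
  obtain ⟨w, hw⟩ := X_pow_dvd_highPart n q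
  have := H.ne_zero
  rw [hw, map_mul, map_pow, aeval_X, mul_div_cancel_left₀ _ (pow_ne_zero _ this)]
  exact P.val_aeval_le h w

theorem val_div_pow_le (H : IsCover p ρ l f x y) (P : CurvePoint k F) {c : k} (hc : c ≠ 0)
    (h : P.val (x - algebraMap k F c) < 1) (q : k[X]) (n : ℕ) :
    P.val (aeval x q / x ^ n) ≤ 1 := by
  rw [map_div₀, map_pow, H.val_eq_one hc h, one_pow, div_one]
  exact P.val_aeval_le (P.val_le_one_of_val_sub_lt h) q

theorem smul_omegaHol_mem [IsAlgClosed k] [CharP k p] (H : IsCover p ρ l f x y)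
    (P : CurvePoint k F) {c : k} (h : P.val (x - algebraMap k F c) < 1) {μ : ℕ} (hμ : μ < p)
    {z : F} (hz : P.val z ≤ 1) : z • omegaHol p ρ l x y μ 1 ∈ P.differentials := by
  rw [omegaHol, smul_smul, Nat.sub_self, pow_zero, one_mul]
  exact H.base_mem_differentials P h hμ hz

theorem val_pred_le (P : CurvePoint k F) (n : ℕ) : P.val ((n : F) - 1) ≤ 1 := by
  have := P.val_algebraMap_le ((n : k) - 1)
  simpa using this

/-- Over ρ_i the resulting exponent is p m_i^{(p-μ)} - (μ-1) l_i - 1. It is nonnegative because p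
does not divide (μ-1) l_i, so the ceiling is strict. -/
theorem smul_omega_mem [IsAlgClosed k] [CharP k p] (H : IsCover p ρ l f x y)
    (P : CurvePoint k F) {c : k} (h : P.val (x - algebraMap k F c) < 1) {μ : ℕ} (hμ : 2 ≤ μ)
    (hμp : μ ≤ p) {z : F} (hz : P.val z ≤ 1) : z • omega p ρ l x y μ ∈ P.differentials := by
  rw [omega, smul_smul, prod_eq_aeval ρ (fun i => l i + 1)]
  have hn := val_pred_le (k := k) P μ
  by_cases hc : ∀ i, ρ i ≠ c
  · rw [H.mem_differentials_of_ne P h hc, map_mul, map_div₀, map_mul, map_mul, map_pow,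
      H.val_g_of_ne P h hc, val_aeval_prod_of_ne P h hc, div_one, mul_one]
    exact mul_le_one' hz (mul_le_one' hn (pow_le_one₀ zero_le (H.val_y_of_ne P h hc)))
  · push Not at hc
    obtain ⟨i, rfl⟩ := hc
    have hne := (P.val.ne_zero_iff).2 (H.sub_ne_zero (ρ i))
    have e : z * (((μ : F) - 1) * aeval x (g p ρ l (p - μ)) * y ^ (μ - 2) /
        aeval x (∏ i, (X - C (ρ i)) ^ (l i + 1))) = (z * ((μ : F) - 1)) *
        (aeval x (g p ρ l (p - μ)) / aeval x (∏ i, (X - C (ρ i)) ^ (l i + 1)) * y ^ (μ - 2)) := by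
      ring
    have hv : P.val (aeval x (g p ρ l (p - μ)) / aeval x (∏ i, (X - C (ρ i)) ^ (l i + 1))) =
        P.val (x - algebraMap k F (ρ i)) ^ ((m p (p - μ) (l i) : ℤ) - (l i + 1 : ℕ)) := by
      rw [map_div₀, H.val_g_of_eq P h, val_aeval_prod_of_eq P H.injective h (fun i => l i + 1),
        zpow_sub₀ hne, zpow_natCast _ (l i + 1)]
    rw [H.mem_differentials_of_eq P h, e, map_mul, mul_pow, mul_assoc,
      H.val_mul_pow_of_eq P h hv, ← zpow_natCast _ ((p - 1) * (l i + 1)), ← zpow_add₀ hne, map_mul]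
    refine mul_le_one' (pow_le_one₀ zero_le (mul_le_one' hz hn)) ((H.zpow_le_one_iff P h).2 ?_)
    have h3 := le_mul_m H.prime.pos (p - μ) (l i)
    have h4 : p - 1 - (p - μ) = μ - 1 := by omega
    rw [h4] at h3
    have h3' : (((μ - 1) * l i : ℕ) : ℤ) ≤ p * m p (p - μ) (l i) := by exact_mod_cast h3
    push_cast [Nat.cast_sub (by omega : 1 ≤ μ)] at h3'
    have h5 : ((μ : ℤ) - 1) * l i ≠ p * m p (p - μ) (l i) := fun h5 =>
      H.not_dvd_mul i (n := μ - 1) (by omega) (by rw [abs_lt]; omega)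
        ⟨m p (p - μ) (l i), by rw [← h5]; ring⟩
    have h6 := lt_of_le_of_ne h3' h5
    push_cast [Nat.cast_sub hμ, Nat.cast_sub (by omega : 1 ≤ p)]
    linarith

/-- Counting degrees, z contributes at most -1, g_{p-μ} at most ∑ l_i, the denominator -(∑ l_i + r)
and dx two. The total is at most 1 - r ≤ 0. -/
theorem smul_omega_mem_of_infty [IsAlgClosed k] [CharP k p] (H : IsCover p ρ l f x y)
    (P : CurvePoint k F) (h : 1 < P.val x) (μ : ℕ) {z : F}
    (hz : P.val z ≤ P.val x ^ (-1 : ℤ)) : z • omega p ρ l x y μ ∈ P.differentials := by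
  have h0 : 0 < P.val x := zero_lt_one.trans h
  have hn := val_pred_le (k := k) P μ
  have hd : P.val (aeval x (∏ i, (X - C (ρ i)) ^ (l i + 1))) =
      P.val x ^ ((∑ i, (l i + 1) : ℕ) : ℤ) := by
    rw [P.val_aeval_eq_pow_natDegree h (prod_monic ρ fun i => l i + 1).ne_zero,
      natDegree_prod_sub_pow ρ fun i => l i + 1, zpow_natCast]
  rw [omega, smul_smul, prod_eq_aeval ρ (fun i => l i + 1), H.mem_differentials_of_infty P h]
  have e : z * (((μ : F) - 1) * aeval x (g p ρ l (p - μ)) * y ^ (μ - 2) /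
      aeval x (∏ i, (X - C (ρ i)) ^ (l i + 1))) * x ^ 2 = (((μ : F) - 1) * y ^ (μ - 2)) *
      (z * (aeval x (g p ρ l (p - μ)) / aeval x (∏ i, (X - C (ρ i)) ^ (l i + 1)) * x ^ 2)) := by
    ring
  rw [e, map_mul, map_mul, map_mul, map_mul, map_div₀, map_pow, map_pow, H.val_g_of_infty P h, hd]
  refine mul_le_one' (mul_le_one' hn (pow_le_one₀ zero_le (H.val_y_of_infty P h))) ?_
  refine (mul_le_mul_left hz _).trans ?_
  rw [← zpow_natCast _ 2, ← zpow_sub₀ h0.ne', ← zpow_add₀ h0.ne', ← zpow_add₀ h0.ne',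
    val_zpow_le_one_iff_of_infty P h]
  have h1 : t p l (p - μ) ≤ ∑ i, l i := Finset.sum_le_sum fun i _ => m_le H.prime.pos
  have h2 : ∑ i, (l i + 1) = ∑ i, l i + r := by simp [Finset.sum_add_distrib]
  have h3 := H.pos
  rw [h2]
  omega

theorem deltaTriple_mem [IsAlgClosed k] [CharP k p] (H : IsCover p ρ l f x y) (q : DeltaIndex p l) :
    deltaTriple p ρ l x y q.1.1 q.1.2 ∈ deRhamCocycles k x := by
  obtain ⟨⟨μ, ν⟩, hq⟩ := q
  obtain ⟨h1, h2, h3, h4⟩ : μ ≤ p - 1 ∧ 2 ≤ t p l μ ∧ 1 ≤ ν ∧ ν ≤ t p l μ - 1 := hq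
  change deltaTriple p ρ l x y μ ν ∈ _
  have hp := H.three_le
  have hfin : ∀ (P : CurvePoint k F) (c : k), P.val (x - algebraMap k F c) < 1 →
      omegaHol p ρ l x y μ ν ∈ P.differentials := fun P c hP => by
    rw [omegaHol]
    exact H.base_mem_differentials P hP (by omega)
      (by rw [map_pow]; exact pow_le_one₀ zero_le (P.val_le_one_of_val_sub_lt hP))
  refine ⟨fun P hP => ?_, fun P hP => ?_, zero_mem _, by simp [deltaTriple]⟩
  · rcases H.exists_or_of_mem_openZero hP with ⟨c, _, h⟩ | h
    · exact hfin P c h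
    · refine H.base_mem_differentials_of_infty P h μ ?_
      rw [map_pow, ← zpow_natCast, zpow_le_zpow_iff_right₀ h]
      omega
  · obtain ⟨c, hc⟩ := H.exists_of_mem_openInfty hP
    exact hfin P c hc

theorem two_le_of_aIndex (H : IsCover p ρ l f x y) {μ : ℕ} (h1 : 1 ≤ μ)
    (h2 : 2 ≤ t p l (p - μ)) : 2 ≤ μ := by
  by_contra! h
  have : μ = 1 := by omega
  subst this
  rw [t_pred p l H.prime.pos] at h2
  omega

/-- This is the bound that regularity above ∞ requires of the φ-part of ω_0. For μ < p it follows
from t^{(μ-1)} ≥ 1. For μ = p, where t^{(p-1)} = 0, the coefficient of x^ν must vanish. -/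
theorem lowPart_phi_coeff (H : IsCover p ρ l f x y) {μ ν : ℕ} (h1 : 1 ≤ μ) (hμp : μ ≤ p)
    (hν : 1 ≤ ν) (i : ℕ) (hi : (lowPart (ν + 1) (phi p ρ l μ ν)).coeff i ≠ 0) :
    (i : ℤ) ≤ ν - 1 + t p l (μ - 1) := by
  rw [coeff_lowPart] at hi
  split_ifs at hi with hlt
  · rcases hμp.lt_or_eq with h | rfl
    · have := H.one_le_t (μ := μ - 1) (by omega)
      omega
    · have hg : g μ ρ l (μ - 1) = 1 := by
        simp [g, m_pred _ _ H.prime.pos]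
      rcases (Nat.lt_succ_iff.1 hlt).lt_or_eq with h | rfl
      · omega
      · exfalso
        -- With g_{p-1} = 1, φ is x g' - ν g, whose coefficient at x^ν is ν g_ν - ν g_ν = 0.
        apply hi
        obtain ⟨n, rfl⟩ := Nat.exists_eq_add_of_le' hν
        rw [phi, hg, mul_one, mul_one, coeff_sub, coeff_X_mul, coeff_derivative, coeff_C_mul]
        push_cast
        ring
  · exact absurd rfl hi

theorem aTriple_mem [IsAlgClosed k] [CharP k p] (H : IsCover p ρ l f x y) (q : AIndex p l) :
    aTriple p ρ l f x y q.1.1 q.1.2 ∈ deRhamCocycles k x := by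
  obtain ⟨⟨μ, ν⟩, hq⟩ := q
  obtain ⟨h1, hμp, h2, h3, h4⟩ : 1 ≤ μ ∧ μ ≤ p ∧ 2 ≤ t p l (p - μ) ∧ 1 ≤ ν ∧
    ν ≤ t p l (p - μ) - 1 := hq
  change aTriple p ρ l f x y μ ν ∈ _
  have hp := H.three_le
  have hμ2 := H.two_le_of_aIndex h1 h2
  refine ⟨fun P hP => ?_, fun P hP => ?_, ?_, ?_⟩
  · rcases H.exists_or_of_mem_openZero hP with ⟨c, hc, h⟩ | h
    · exact add_mem (H.smul_omegaHol_mem P h (by omega) (H.val_div_pow_le P hc h _ _))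
        (H.smul_omega_mem P h hμ2 hμp (H.val_div_pow_le P hc h _ _))
    · refine add_mem ?_ (H.smul_omega_mem_of_infty P h μ ?_)
      · rw [omegaHol, smul_smul, Nat.sub_self, pow_zero, one_mul]
        refine H.base_mem_differentials_of_infty P h _ ?_
        convert H.val_lowPart_le_of_infty P h (H.lowPart_phi_coeff h1 hμp h3) using 2
        push_cast
        ring
      · convert H.val_lowPart_le_of_infty P h (q := lowPart ν (psi ρ l f)) (e := ν - 1)
          (fun i hi => ?_) using 2
        · ring
        · rw [coeff_lowPart] at hi
          split_ifs at hi with hlt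
          · omega
          · exact absurd rfl hi
  · obtain ⟨c, h⟩ := H.exists_of_mem_openInfty hP
    have hx := P.val_le_one_of_val_sub_lt h
    exact neg_mem (add_mem (H.smul_omegaHol_mem P h (by omega) (H.val_highPart_le P hx _ _))
        (H.smul_omega_mem P h hμ2 hμp (H.val_highPart_le P hx _ _)))
  · change hTilde p ρ l x y μ ν ∈ _
    rw [hTilde_eq p ρ l x y h1 hμp]
    exact H.baseFun_mem _
  · change KaehlerDifferential.D k F (hTilde p ρ l x y μ ν) = _
    rw [H.D_hTilde h1 h3]
    conv_lhs => rw [← lowPart_add_highPart (ν + 1) (phi p ρ l μ ν),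
      ← lowPart_add_highPart ν (psi ρ l f)]
    simp only [aTriple, map_add, add_div, add_smul]
    abel

end IsCover

/-- The index of `h̃_{μ,ν}` among the functions `baseFun`. -/
def AIndex.toBase {p : ℕ} {l : Fin r → ℕ} (q : AIndex p l) : ℤ × Fin p :=
  (-(q.1.2 : ℤ), ⟨q.1.1 - 1, by have := q.2.1; have := q.2.2.1; omega⟩)

theorem AIndex.toBase_injective {p : ℕ} {l : Fin r → ℕ} :
    Function.Injective (AIndex.toBase : AIndex p l → ℤ × Fin p) := by
  rintro ⟨⟨μ, ν⟩, h⟩ ⟨⟨μ', ν'⟩, h'⟩ e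
  have h1 : 1 ≤ μ := h.1
  have h2 : 1 ≤ μ' := h'.1
  simp only [AIndex.toBase, Prod.mk.injEq, Fin.mk.injEq] at e
  refine Subtype.ext (Prod.ext ?_ ?_) <;> simp only <;> omega

/-- These are the exponents belonging neither to functions on U_∞ nor to functions on U_0. The
requirement t ≥ 2 is automatic, since otherwise the gap is empty. -/
theorem AIndex.mem_range_toBase {p : ℕ} {l : Fin r → ℕ} {i : ℤ × Fin p} :
    i ∈ Set.range (AIndex.toBase : AIndex p l → ℤ × Fin p) ↔
      i.1 < 0 ∧ -(t p l (p - 1 - i.2) : ℤ) < i.1 := by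
  constructor
  · rintro ⟨⟨⟨μ, ν⟩, hq⟩, rfl⟩
    obtain ⟨h1, hμp, h2, h3, h4⟩ : 1 ≤ μ ∧ μ ≤ p ∧ 2 ≤ t p l (p - μ) ∧ 1 ≤ ν ∧
      ν ≤ t p l (p - μ) - 1 := hq
    have e : p - 1 - (μ - 1) = p - μ := by omega
    simp only [AIndex.toBase, e]
    omega
  · obtain ⟨j, ⟨μ, hμ⟩⟩ := i
    rintro ⟨h1, h2⟩
    simp only at h1 h2
    have e : p - 1 - μ = p - (μ + 1) := by omega
    rw [e] at h2
    refine ⟨⟨(μ + 1, (-j).toNat), by simp, by simpa using hμ, ?_, ?_, ?_⟩, ?_⟩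
    · simp only
      omega
    · simp only
      omega
    · simp only
      omega
    · simp only [AIndex.toBase, Prod.mk.injEq, Fin.mk.injEq]
      omega

/-- The index of `ω_{μ,ν}` among the forms `baseForm`. -/
def DeltaIndex.toBase {p : ℕ} (hp : 0 < p) {l : Fin r → ℕ} (q : DeltaIndex p l) : ℤ × Fin p :=
  ((q.1.2 : ℤ) - 1, ⟨q.1.1, by have := q.2.1; omega⟩)

theorem DeltaIndex.toBase_injective {p : ℕ} (hp : 0 < p) {l : Fin r → ℕ} :
    Function.Injective (DeltaIndex.toBase hp : DeltaIndex p l → ℤ × Fin p) := by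
  rintro ⟨⟨μ, ν⟩, h⟩ ⟨⟨μ', ν'⟩, h'⟩ e
  simp only [DeltaIndex.toBase, Prod.mk.injEq, Fin.mk.injEq] at e
  refine Subtype.ext (Prod.ext ?_ ?_) <;> simp only <;> omega

theorem DeltaIndex.mem_range_toBase {p : ℕ} (hp : 0 < p) {l : Fin r → ℕ} {i : ℤ × Fin p}
    (hi : 0 ≤ i.1 ∧ i.1 ≤ (t p l i.2 : ℤ) - 2) :
    i ∈ Set.range (DeltaIndex.toBase hp : DeltaIndex p l → ℤ × Fin p) := by
  obtain ⟨j, ⟨μ, hμ⟩⟩ := i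
  simp only at hi
  refine ⟨⟨(μ, (j + 1).toNat), ?_, ?_, ?_, ?_⟩, ?_⟩
  · simp only
    omega
  · simp only
    omega
  · simp only
    omega
  · simp only
    omega
  · exact Prod.ext (by simp only [DeltaIndex.toBase]; omega) rfl

/-! ### The extension of H¹(X, 𝒪) by the regular differentials -/

namespace IsCover

variable {p : ℕ} {ρ : Fin r → k} {l : Fin r → ℕ} {f : k[X]} {x y : F}

/-- The cocycle `(ω_0, ω_∞, h̃_{μ,ν})`. -/
noncomputable def aCocycle [IsAlgClosed k] [CharP k p] (H : IsCover p ρ l f x y) (q : AIndex p l) :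
    deRhamCocycles k x :=
  ⟨aTriple p ρ l f x y q.1.1 q.1.2, H.aTriple_mem q⟩

/-- The cocycle `(ω_{μ,ν}, ω_{μ,ν}, 0)`. -/
noncomputable def deltaCocycle [IsAlgClosed k] [CharP k p] (H : IsCover p ρ l f x y)
    (q : DeltaIndex p l) : deRhamCocycles k x :=
  ⟨deltaTriple p ρ l x y q.1.1 q.1.2, H.deltaTriple_mem q⟩

/-- The function underlying a cocycle. -/
noncomputable def cocycleFun (k : Type*) {F : Type*} [Field k] [Field F] [Algebra k F] (x : F) :
    deRhamCocycles k x →ₗ[k] F :=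
  LinearMap.snd k _ F ∘ₗ LinearMap.snd k _ _ ∘ₗ (deRhamCocycles k x).subtype

theorem cocycleFun_apply (z : deRhamCocycles k x) : cocycleFun k x z = z.1.2.2 := rfl

theorem cocycleFun_aCocycle [IsAlgClosed k] [CharP k p] (H : IsCover p ρ l f x y)
    (q : AIndex p l) : cocycleFun k x (H.aCocycle q) = baseFun p ρ l x y q.toBase :=
  hTilde_eq p ρ l x y q.2.1 q.2.2.1

/-- Functions which are regular everywhere are constant. -/
theorem D_eq_zero_of_mem [IsAlgClosed k] [CharP k p] (H : IsCover p ρ l f x y) {h : F}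
    (h0 : h ∈ regularFunctions (openZero k x)) (h1 : h ∈ regularFunctions (openInfty k x)) :
    KaehlerDifferential.D k F h = 0 := by
  have key := H.mem_span_baseFun True True (fun P hP => h0 P hP.1) (fun _ => h1) (fun _ => h0)
  have hle : Submodule.span k (baseFun p ρ l x y '' {i | (True → 0 ≤ i.1) ∧
      (True → i.1 ≤ -(t p l (p - 1 - i.2) : ℤ))}) ≤
      LinearMap.ker (KaehlerDifferential.D k F).toLinearMap := by
    rw [Submodule.span_le]
    rintro _ ⟨⟨j, μ, hμ⟩, ⟨h1, h2⟩, rfl⟩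
    have h1 : 0 ≤ j := h1 trivial
    have h2 : j ≤ -(t p l (p - 1 - μ) : ℤ) := h2 trivial
    -- For μ > 0 one has t^{(p-1-μ)} ≥ 1, so 0 ≤ j ≤ -t has no solution; for μ = 0 it leaves only j
    -- = 0 and the constant 1.
    have hμ0 : μ = 0 := by
      by_contra h
      have := H.one_le_t (μ := p - 1 - μ) (by omega)
      omega
    subst hμ0
    have hj : j = 0 := by omega
    subst hj
    have hg : g p ρ l (p - 1) = 1 := by
      simp [g, m_pred _ _ H.prime.pos]
    simp [baseFun, hg]
  exact hle key

/-- A cocycle with zero function has ω_0 = ω_∞, a global regular differential, to which the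
coefficientwise description applies. -/
theorem mem_span_deltaCocycle [IsAlgClosed k] [CharP k p] (H : IsCover p ρ l f x y)
    {z : deRhamCocycles k x} (hz : cocycleFun k x z = 0) :
    z ∈ Submodule.span k (Set.range H.deltaCocycle) := by
  obtain ⟨⟨ω, ω', h⟩, hc⟩ := z
  obtain rfl : h = 0 := hz
  obtain ⟨h0, h1, -, h3⟩ := id hc
  simp only [map_zero] at h3
  obtain rfl : ω = ω' := sub_eq_zero.1 h3.symm
  obtain ⟨b, rfl⟩ := H.exists_eq_smul_D ω
  have key := H.mem_span_baseForm h0 h1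
  let T : F →ₗ[k] Ω[F⁄k] × Ω[F⁄k] × F :=
    let T₀ := (LinearMap.toSpanSingleton F Ω[F⁄k] (KaehlerDifferential.D k F x)).restrictScalars k
    T₀.prod (T₀.prod 0)
  have h4 := Submodule.mem_map_of_mem (f := T) key
  rw [Submodule.map_span] at h4
  have h5 : Submodule.span k (T '' (baseForm p ρ l x y '' {i | 0 ≤ i.1 ∧
      i.1 ≤ (t p l i.2 : ℤ) - 2})) ≤
      (Submodule.span k (Set.range H.deltaCocycle)).map (deRhamCocycles k x).subtype := by
    rw [Submodule.span_le]
    rintro _ ⟨_, ⟨i, hi, rfl⟩, rfl⟩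
    obtain ⟨q, rfl⟩ := DeltaIndex.mem_range_toBase H.prime.pos hi
    refine ⟨_, Submodule.subset_span ⟨q, rfl⟩, ?_⟩
    have := omegaHol_eq p ρ l x y (DeltaIndex.toBase H.prime.pos q).2.2 q.2.2.2.1
    change (_, _, _) = (_, _, _)
    rw [DeltaIndex.toBase]
    refine Prod.ext this (Prod.ext this rfl)
  obtain ⟨z, hz, e⟩ := h5 h4
  exact (show z = ⟨_, hc⟩ from Subtype.ext e) ▸ hz

theorem linearIndependent_delta [IsAlgClosed k] [CharP k p] (H : IsCover p ρ l f x y) :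
    LinearIndependent k fun q => deRhamClass x _ (H.deltaCocycle q).2 := by
  have h1 : LinearIndependent k H.deltaCocycle := by
    refine LinearIndependent.of_comp (LinearMap.fst k _ _ ∘ₗ (deRhamCocycles k x).subtype) ?_
    have h2 := (H.linearIndependent_baseForm.comp _
      (DeltaIndex.toBase_injective (l := l) H.prime.pos)).map'
      ((LinearMap.toSpanSingleton F Ω[F⁄k] (KaehlerDifferential.D k F x)).restrictScalars k)
      (LinearMap.ker_eq_bot.2 (smul_left_injective F H.D_ne_zero))
    have e : (LinearMap.fst k _ _ ∘ₗ (deRhamCocycles k x).subtype) ∘ H.deltaCocycle =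
        (LinearMap.toSpanSingleton F Ω[F⁄k] (KaehlerDifferential.D k F x)).restrictScalars k ∘
          baseForm p ρ l x y ∘ DeltaIndex.toBase H.prime.pos := funext fun q =>
      omegaHol_eq p ρ l x y (DeltaIndex.toBase H.prime.pos q).2.2 q.2.2.2.1
    rw [e]
    exact h2
  refine h1.map (f := Submodule.mkQ ((deRhamCoboundaries k x).submoduleOf
    (deRhamCocycles k x))) ?_
  rw [Submodule.ker_mkQ, Submodule.disjoint_def]
  intro z hz hB
  have hs : Submodule.span k (Set.range H.deltaCocycle) ≤ LinearMap.ker (cocycleFun k x) := by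
    rw [Submodule.span_le]
    rintro _ ⟨q, rfl⟩
    rfl
  have hz0 : z.1.2.2 = 0 := hs hz
  obtain ⟨h₀, hh₀, h₁, hh₁, e⟩ : z.1 ∈ deRhamCoboundaries k x := hB
  rw [e] at hz0
  -- A coboundary with zero function comes from a single function regular on all of X, whose
  -- differential is zero.
  obtain rfl : h₀ = h₁ := sub_eq_zero.1 hz0
  refine Subtype.ext (e.trans ?_)
  rw [H.D_eq_zero_of_mem hh₀ hh₁, sub_self]
  rfl

/-- The map from `H¹_dR(X/k)` to `H¹(X, 𝒪_X)`. -/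
noncomputable def toStructureSheafH1 (k : Type*) {F : Type*} [Field k] [Field F] [Algebra k F] (x : F) :
    DeRhamH1 k x →ₗ[k]
      F ⧸ (regularFunctions (openZero k x) ⊔ regularFunctions (openInfty k x)) :=
  Submodule.liftQ _ (Submodule.mkQ _ ∘ₗ cocycleFun k x) (by
    rintro z ⟨h₀, hh₀, h₁, hh₁, e⟩
    rw [LinearMap.mem_ker, LinearMap.comp_apply, Submodule.mkQ_apply,
      Submodule.Quotient.mk_eq_zero, cocycleFun_apply]
    rw [Submodule.coe_subtype] at e
    rw [e]
    exact sub_mem (Submodule.mem_sup_left hh₀) (Submodule.mem_sup_right hh₁))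

/-- The functions on U_0 and on U_∞ lie in spans of members of the independent family `baseFun`
whose indices avoid those of the `h̃`. -/
theorem linearIndependent_toStructureSheafH1 [IsAlgClosed k] [CharP k p] (H : IsCover p ρ l f x y) :
    LinearIndependent k (toStructureSheafH1 k x ∘ fun q => deRhamClass x _ (H.aCocycle q).2) := by
  have h1 := H.linearIndependent_baseFun.comp _ (AIndex.toBase_injective (l := l))
  have h2 := h1.map (f := Submodule.mkQ (regularFunctions (openZero k x) ⊔
    regularFunctions (openInfty k x))) ?_
  · have e : (toStructureSheafH1 k x ∘ fun q => deRhamClass x _ (H.aCocycle q).2) =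
        Submodule.mkQ (regularFunctions (openZero k x) ⊔ regularFunctions (openInfty k x)) ∘
          baseFun p ρ l x y ∘ AIndex.toBase := funext fun q =>
      congrArg (Submodule.mkQ _) (H.cocycleFun_aCocycle q)
    rw [e]
    exact h2
  rw [Submodule.ker_mkQ, Set.range_comp]
  refine (H.linearIndependent_baseFun.disjoint_span_image (t := {i | 0 ≤ i.1} ∪
    {i | i.1 ≤ -(t p l (p - 1 - i.2) : ℤ)}) ?_).mono_right (sup_le ?_ ?_)
  · rw [Set.disjoint_left]
    intro i hi hi'
    rw [AIndex.mem_range_toBase] at hi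
    rcases hi' with hi' | hi' <;> simp only [Set.mem_ofPred_eq] at hi' <;> omega
  · intro h hh
    have := H.mem_span_baseFun False True (fun P hP => hh P hP.1) False.elim (fun _ => hh)
    exact Submodule.span_mono (Set.image_mono fun i hi => Or.inr (hi.2 trivial)) this
  · intro h hh
    have := H.mem_span_baseFun True False (fun P hP => hh P hP.2) (fun _ => hh) False.elim
    exact Submodule.span_mono (Set.image_mono fun i hi => Or.inl (hi.1 trivial)) this

/-- The δ-classes die in H¹(X, 𝒪), where the images of the a-classes remain independent; so the two
spans meet trivially. -/
theorem linearIndependent_sum [IsAlgClosed k] [CharP k p] (H : IsCover p ρ l f x y) :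
    LinearIndependent k (Sum.elim (fun q => deRhamClass x _ (H.aCocycle q).2)
      (fun q => deRhamClass x _ (H.deltaCocycle q).2)) := by
  refine LinearIndependent.sum_type (LinearIndependent.of_comp _ H.linearIndependent_toStructureSheafH1)
    H.linearIndependent_delta ((Submodule.range_ker_disjoint H.linearIndependent_toStructureSheafH1).mono_right ?_)
  rw [Submodule.span_le]
  rintro _ ⟨q, rfl⟩
  exact map_zero (Submodule.mkQ _)

/-- Modulo functions on U_0 and U_∞ the function of `z` is a combination of the `h̃`. Subtracting
that combination of cocycles and a coboundary leaves a cocycle with zero function. -/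
theorem mem_sup_span [IsAlgClosed k] [CharP k p] (H : IsCover p ρ l f x y)
    (z : deRhamCocycles k x) :
    z ∈ Submodule.span k (Set.range H.aCocycle) ⊔ Submodule.span k (Set.range H.deltaCocycle) ⊔
      (deRhamCoboundaries k x).submoduleOf (deRhamCocycles k x) := by
  have h1 := H.mem_span_baseFun False False z.2.2.2.1 False.elim False.elim
  have h2 : z.1.2.2 ∈ (Submodule.span k (Set.range H.aCocycle)).map (cocycleFun k x) ⊔
      (regularFunctions (openZero k x) ⊔ regularFunctions (openInfty k x)) := by
    refine Submodule.span_le.2 ?_ h1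
    rintro _ ⟨i, -, rfl⟩
    by_cases hi : i ∈ Set.range (AIndex.toBase : AIndex p l → ℤ × Fin p)
    · obtain ⟨q, rfl⟩ := hi
      exact Submodule.mem_sup_left
        ⟨_, Submodule.subset_span ⟨q, rfl⟩, H.cocycleFun_aCocycle q⟩
    · refine Submodule.mem_sup_right ?_
      rw [AIndex.mem_range_toBase, not_and_or, not_lt, not_lt] at hi
      rcases hi with hi | hi
      · exact Submodule.mem_sup_right (H.baseFun_mem_openInfty hi)
      · exact Submodule.mem_sup_left (H.baseFun_mem_openZero hi)
  obtain ⟨_, ⟨a, ha, rfl⟩, w, hw, e⟩ := Submodule.mem_sup.1 h2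
  obtain ⟨h₀, hh₀, h₁, hh₁, rfl⟩ := Submodule.mem_sup.1 hw
  -- The sign turns the sum h₀ + h₁ into the difference required of a coboundary.
  have hb : (KaehlerDifferential.D k F h₀, KaehlerDifferential.D k F (-h₁), h₀ - -h₁) ∈
      deRhamCoboundaries k x := ⟨h₀, hh₀, -h₁, neg_mem hh₁, rfl⟩
  let b : deRhamCocycles k x := ⟨_, deRhamCoboundaries_le x hb⟩
  have hd : cocycleFun k x (z - a - b) = 0 := by
    rw [map_sub, map_sub, cocycleFun_apply z, ← e, cocycleFun_apply b]
    simp only [b]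
    ring
  have : z = a + (z - a - b) + b := by abel
  rw [this]
  exact add_mem (Submodule.mem_sup_left (add_mem (Submodule.mem_sup_left ha)
    (Submodule.mem_sup_right (H.mem_span_deltaCocycle hd)))) (Submodule.mem_sup_right hb)

theorem top_le_span [IsAlgClosed k] [CharP k p] (H : IsCover p ρ l f x y) :
    ⊤ ≤ Submodule.span k (Set.range (Sum.elim (fun q => deRhamClass x _ (H.aCocycle q).2)
      (fun q => deRhamClass x _ (H.deltaCocycle q).2))) := by
  rintro c -
  obtain ⟨z, rfl⟩ := Submodule.mkQ_surjective _ c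
  have h := Submodule.mem_map_of_mem (f := Submodule.mkQ ((deRhamCoboundaries k x).submoduleOf
    (deRhamCocycles k x))) (H.mem_sup_span z)
  rw [Submodule.map_sup, Submodule.map_sup, Submodule.map_span, Submodule.map_span,
    Submodule.mkQ_map_self, sup_bot_eq, ← Set.range_comp, ← Set.range_comp,
    ← Submodule.span_union] at h
  rw [Set.Sum.elim_range]
  exact h

end IsCover

end ArtinSchreier

theorem mainTheorem2 {k F : Type*} [Field k] [IsAlgClosed k] [Field F] [Algebra k F]
    (p : ℕ) [CharP k p] (hp : p.Prime) (hp3 : 3 ≤ p)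
    (r : ℕ) (hr : 1 ≤ r)
    (ρ : Fin r → k) (hρ : Function.Injective ρ)
    (l : Fin r → ℕ) (hl : ∀ i, 1 ≤ l i) (hlp : ∀ i, (l i).Coprime p)
    (f : Polynomial k)
    (hf : IsCoprime f (∏ i, (Polynomial.X - Polynomial.C (ρ i)) ^ l i))
    (hf0 : ¬ Polynomial.X ∣ f)
    (hfdeg : f.natDegree = ∑ i, l i)
    (x y : F) (hx : Transcendental k x)
    (hF : IntermediateField.adjoin k {x, y} = ⊤)
    (hxy : y ^ p - y =
      Polynomial.aeval x f / ∏ i, (x - algebraMap k F (ρ i)) ^ l i) :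
    ∃ (ha : ∀ q : ArtinSchreier.AIndex p l,
          ArtinSchreier.aTriple p ρ l f x y q.1.1 q.1.2 ∈ deRhamCocycles k x)
      (hδ : ∀ q : ArtinSchreier.DeltaIndex p l,
          ArtinSchreier.deltaTriple p ρ l x y q.1.1 q.1.2 ∈ deRhamCocycles k x)
      (b : Module.Basis (ArtinSchreier.AIndex p l ⊕ ArtinSchreier.DeltaIndex p l) k
          (DeRhamH1 k x)),
      (∀ q : ArtinSchreier.AIndex p l,
        b (Sum.inl q) = deRhamClass x (ArtinSchreier.aTriple p ρ l f x y q.1.1 q.1.2) (ha q)) ∧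
      (∀ q : ArtinSchreier.DeltaIndex p l,
        b (Sum.inr q) = deRhamClass x (ArtinSchreier.deltaTriple p ρ l x y q.1.1 q.1.2) (hδ q)) := by
  have H : ArtinSchreier.IsCover p ρ l f x y := ⟨hp, hp3, hr, hρ, hl, hlp, hf, hfdeg, hx, hF, by
    rw [hxy, ArtinSchreier.IsCover.prod_eq_aeval]⟩
  refine ⟨H.aTriple_mem, H.deltaTriple_mem,
    Module.Basis.mk H.linearIndependent_sum H.top_le_span, fun q => ?_, fun q => ?_⟩
  · rw [Module.Basis.mk_apply]
    rfl
  · rw [Module.Basis.mk_apply]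
    rfl
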